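/- Let $\alpha\in\mathbb R$ be irrational and let $\mathbb A_{2\alpha}$ be the noncommutative torus, i.e. the universal unital $C^*$-algebra generated by two unitaries $U,V$ with $UV=e^{4\pi i\alpha}VU$. Put $W(m,n)=e^{-2\pi i\alpha mn}U^mV^n$ and $W(f)=\sum_{m,n}f(m,n)W(m,n)$ for finitely supported $f:\mathbb Z^2\to\mathbb C$. Let $\mu$ be a Borel probability measure on the circle $\mathbb T$, let $R$ be the rotation of $\mathbb T$ by the angle $2\pi\alpha$, and let $\mu_n=\mu\circ R^{-n}$ for $n\in\mathbb Z$. There is a unique positive linear functional $\omega_\mu$ on $\mathbb A_{2\alpha}$ (a state) with $$\omega_\mu(W(f))=\sum_{m\in\mathbb Z}f(m,0)\int_{\mathbb T}z^m\,d\mu(z)$$ for all finitely supported $f$. Its GNS Hilbert space is identified with $\mathcal H=\bigoplus_{n\in\mathbb Z}L^2(\mathbb T,\mu_n)$ through the unitary that sends $\pi_{\omega_\mu}(W(f))\xi_{\omega_\mu}$ to the vector with components $z\mapsto\sum_{m}f(m,n)z^m$, $n\in\mathbb Z$. Let $S$ be the closure of the conjugate-linear map $\pi_{\omega_\mu}(a)\xi_{\omega_\mu}\mapsto\pi_{\omega_\mu}(a^*)\xi_{\omega_\mu}$,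 $a\in\mathbb A_{2\alpha}$, and let $S=J\Delta^{1/2}$ be its polar decomposition, where $J$ is antiunitary and $\Delta^{1/2}$ is the positive self-adjoint square root of $\Delta$; $\Delta$ and $J$ are the Tomita modular operator and conjugation of $\omega_\mu$. **Theorem.** Suppose that $\mu_{-n}\sim\mu_n$ (mutual absolute continuity) for all $n\in\mathbb Z$, with Radon–Nikodym derivatives $h_n=\frac{d\mu_{-n}}{d\mu_n}$. Then $\Delta$ and $J$ exist, and $$\mathcal D_\Delta=\Big\{x\in\mathcal H\ \Big|\ \sum_{n\in\mathbb Z}\int_{\mathbb T}|h_n(z)x_n(z)|^2\,d\mu_n(z)<\infty\Big\},$$ $$(\Delta x)_n(z)=h_n(z)\,x_n(z)\quad(x\in\mathcal D_\Delta),\qquad (Jx)_n(z)=h_n(z)^{1/2}\,\overline{x_{-n}(z)}\quad(x\in\mathcal H),$$ for every $n\in\mathbb Z$ and $\mu_n$-almost every $z\in\mathbb T$. -/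

import Mathlib

open MeasureTheory
open scoped ENNReal ComplexConjugate InnerProductSpace ComplexOrder

noncomputable section

/-! ### The noncommutative torus -/

/-- A nonzero unital C⋆-algebra `B` with unitaries `u`, `v` such that `u v = e^{4πiα} v u`. -/
structure TorusPair (α : ℝ) where
  /-- The C⋆-algebra. -/
  B : Type
  /-- Its C⋆-algebra structure. -/
  [alg : CStarAlgebra B]
  [nontriv : Nontrivial B]
  /-- The first unitary. -/
  u : unitary B
  /-- The second unitary. -/
  v : unitary B
  comm : (u * v : B) = (Circle.exp (4 * Real.pi * α) : ℂ) • (v * u : B)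

attribute [instance] TorusPair.alg TorusPair.nontriv

/-- The bounded families in the product of all `TorusPair`s. -/
abbrev TorusProduct (α : ℝ) : Type 1 := lp (fun i : TorusPair α => i.B) ∞

instance (α : ℝ) : CStarAlgebra (TorusProduct α) where
  toStarModule := inferInstance

/-- A family of unitaries, as an element of the product. -/
def TorusProduct.ofUnitary {α : ℝ} (w : ∀ i : TorusPair α, unitary i.B) :
    unitary (TorusProduct α) :=
  ⟨⟨fun i => (w i : i.B), memℓp_infty ⟨1, by
      rintro _ ⟨i, rfl⟩
      exact (CStarRing.norm_of_mem_unitary (w i).2).le⟩⟩, by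
    constructor <;> ext i
    · exact Unitary.coe_star_mul_self (w i)
    · exact Unitary.coe_mul_star_self (w i)⟩

/-- The closed unital ⋆-subalgebra generated by the two universal unitaries. -/
def torusSubalgebra (α : ℝ) : StarSubalgebra ℂ (TorusProduct α) :=
  (StarAlgebra.adjoin ℂ
    {(TorusProduct.ofUnitary (fun i : TorusPair α => i.u) : TorusProduct α),
     (TorusProduct.ofUnitary (fun i : TorusPair α => i.v) : TorusProduct α)}).topologicalClosure

/-- The noncommutative torus `𝔸_{2α}`: the universal unital C⋆-algebra generated by two
unitaries `U`, `V` with `U V = e^{4πiα} V U`. It is realised as the C⋆-algebra generated by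
the families `(u_i)`, `(v_i)`, where `(B_i, u_i, v_i)` runs over all realisations. -/
def NCTorus (α : ℝ) : Type 1 := torusSubalgebra α

namespace NCTorus

variable (α : ℝ)

instance : CStarAlgebra (NCTorus α) :=
  haveI : IsClosed (torusSubalgebra α : Set (TorusProduct α)) :=
    StarSubalgebra.isClosed_topologicalClosure _
  inferInstanceAs (CStarAlgebra (torusSubalgebra α))

instance : PartialOrder (NCTorus α) := CStarAlgebra.spectralOrder _

instance : StarOrderedRing (NCTorus α) := CStarAlgebra.spectralOrderedRing _

/-- The first generator. -/
def U : unitary (NCTorus α) :=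
  ⟨⟨(TorusProduct.ofUnitary (fun i : TorusPair α => i.u) : TorusProduct α),
      StarSubalgebra.le_topologicalClosure _ (StarAlgebra.subset_adjoin ℂ _ (by simp))⟩,
    Subtype.ext (TorusProduct.ofUnitary (fun i : TorusPair α => i.u)).2.1,
    Subtype.ext (TorusProduct.ofUnitary (fun i : TorusPair α => i.u)).2.2⟩

/-- The second generator. -/
def V : unitary (NCTorus α) :=
  ⟨⟨(TorusProduct.ofUnitary (fun i : TorusPair α => i.v) : TorusProduct α),
      StarSubalgebra.le_topologicalClosure _ (StarAlgebra.subset_adjoin ℂ _ (by simp))⟩,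
    Subtype.ext (TorusProduct.ofUnitary (fun i : TorusPair α => i.v)).2.1,
    Subtype.ext (TorusProduct.ofUnitary (fun i : TorusPair α => i.v)).2.2⟩

theorem U_mul_V : (U α * V α : NCTorus α) =
    (Circle.exp (4 * Real.pi * α) : ℂ) • (V α * U α : NCTorus α) :=
  Subtype.ext (lp.ext (funext fun i => i.comm))

/-- The universal property of the noncommutative torus. -/
theorem existsUnique_hom (i : TorusPair α) :
    ∃! φ : NCTorus α →⋆ₐ[ℂ] i.B, φ (U α) = i.u ∧ φ (V α) = i.v := by
  let ψ : NCTorus α →⋆ₐ[ℂ] i.B :=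
    { toFun := fun x => (x.1 : ∀ i : TorusPair α, i.B) i
      map_one' := rfl
      map_mul' := fun _ _ => rfl
      map_zero' := rfl
      map_add' := fun _ _ => rfl
      commutes' := fun _ => rfl
      map_star' := fun _ => rfl }
  refine ⟨ψ, ⟨rfl, rfl⟩, fun φ hφ => ?_⟩
  have h1 : φ (U α) = ψ (U α) := by rw [hφ.1]; rfl
  have h2 : φ (V α) = ψ (V α) := by rw [hφ.2]; rfl
  refine StarAlgHom.ext_topologicalClosure (S := StarAlgebra.adjoin ℂ
    {(TorusProduct.ofUnitary (fun i : TorusPair α => i.u) : TorusProduct α),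
     (TorusProduct.ofUnitary (fun i : TorusPair α => i.v) : TorusProduct α)})
    (φ := φ) (ψ := ψ)
    (AddMonoidHomClass.continuous_of_bound φ 1 fun x => by
      simpa using NonUnitalStarAlgHom.norm_apply_le φ x)
    (AddMonoidHomClass.continuous_of_bound ψ 1 fun x => by
      simpa using NonUnitalStarAlgHom.norm_apply_le ψ x) ?_
  refine StarAlgHom.ext_adjoin ?_
  rintro ⟨x, hx⟩ (rfl | rfl)
  · exact h1
  · exact h2

/-- The Weyl elements `W(m,n) = e^{-2πiαmn} U^m V^n`. -/
def weyl (a : ℤ × ℤ) : NCTorus α :=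
  (Circle.exp (-(2 * Real.pi * α * a.1 * a.2)) : ℂ) •
    ((U α ^ a.1 * V α ^ a.2 : unitary (NCTorus α)) : NCTorus α)

/-- `W(f) = ∑ f(a) W(a)` for a finitely supported `f` on `ℤ²`. -/
def W (f : ℤ × ℤ →₀ ℂ) : NCTorus α := f.sum fun a c => c • weyl α a

end NCTorus

/-! ### Tomita modular theory of a positive functional -/

section Tomita

variable {H : Type*} [NormedAddCommGroup H] [InnerProductSpace ℂ H] [CompleteSpace H]

/-- `S = J T` is the polar decomposition of the (graph of the) conjugate-linear operator `S`:
`T` is positive self-adjoint, `J` is antiunitary, and `S` and `J T` have the same domain and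
the same values. -/
structure IsPolarDecomposition (S : Set (H × H)) (J : H ≃ₗᵢ⋆[ℂ] H) (T : H →ₗ.[ℂ] H) : Prop where
  isSelfAdjoint : IsSelfAdjoint T
  nonneg : ∀ x : T.domain, 0 ≤ ⟪(x : H), T x⟫_ℂ
  graph_eq : ∀ x y : H, (x, y) ∈ S ↔ ∃ hx : x ∈ T.domain, J (T ⟨x, hx⟩) = y

/-- `Δ = T²`, with the natural domain `{x ∈ dom T | T x ∈ dom T}`. -/
def IsOperatorSquare (Δ T : H →ₗ.[ℂ] H) : Prop :=
  ∀ x y : H, (x, y) ∈ Δ.graph ↔ ∃ z : H, (x, z) ∈ T.graph ∧ (z, y) ∈ T.graph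

variable {A : Type*} [CStarAlgebra A] [PartialOrder A] [StarOrderedRing A]

/-- The cyclic vector `ξ_ω` of the GNS representation of `ω`. -/
def gnsVector (ω : A →ₚ[ℂ] ℂ) : ω.GNS := ((ω.toPreGNS 1 : ω.PreGNS) : ω.GNS)

/-- The graph of the Tomita involution: the closure of
`{(π_ω(a) ξ_ω, π_ω(a⋆) ξ_ω) | a ∈ A}`. -/
def tomitaGraph (ω : A →ₚ[ℂ] ℂ) : Set (ω.GNS × ω.GNS) :=
  closure {p | ∃ a : A,
    p = (ω.gnsStarAlgHom a (gnsVector ω), ω.gnsStarAlgHom (star a) (gnsVector ω))}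

/-- `Δ` and `J` are the Tomita modular operator and conjugation of `ω`: the polar decomposition
of the Tomita involution is `S = J Δ^{1/2}`, where `Δ^{1/2}` is a positive self-adjoint operator
whose square is `Δ`. -/
def IsModularPair (ω : A →ₚ[ℂ] ℂ) (Δ : ω.GNS →ₗ.[ℂ] ω.GNS) (J : ω.GNS ≃ₗᵢ⋆[ℂ] ω.GNS) : Prop :=
  ∃ T : ω.GNS →ₗ.[ℂ] ω.GNS, IsPolarDecomposition (tomitaGraph ω) J T ∧ IsOperatorSquare Δ T

end Tomita

/-! ### The states associated with measures on the circle -/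

instance : MeasurableSpace Circle := borel Circle

instance : BorelSpace Circle := ⟨rfl⟩

/-- `μ_n = μ ∘ R^{-n}`, with `R` the rotation by the angle `2πα`. -/
def rotMeasure (α : ℝ) (μ : Measure Circle) (n : ℤ) : Measure Circle :=
  μ.map fun z => Circle.exp (2 * Real.pi * α * n) * z

/-- The Radon–Nikodym derivative `h_n = dμ_{-n} / dμ_n`. -/
def rotDensity (α : ℝ) (μ : Measure Circle) (n : ℤ) (z : Circle) : ℝ :=
  ((rotMeasure α μ (-n)).rnDeriv (rotMeasure α μ n) z).toReal

/-- The Hilbert space `⨁_n L²(𝕋, μ_n)`. -/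
abbrev rotHilbert (α : ℝ) (μ : Measure Circle) : Type :=
  lp (fun n : ℤ => Lp ℂ 2 (rotMeasure α μ n)) 2

/-- The trigonometric polynomial `z ↦ ∑_m f(m,n) z^m`. -/
def rowTransform (f : ℤ × ℤ →₀ ℂ) (n : ℤ) (z : Circle) : ℂ :=
  ∑' m : ℤ, f (m, n) * ((z ^ m : Circle) : ℂ)

/-- `ω` is the functional `ω_μ` : `ω_μ(W(f)) = ∑_m (∫ z^m dμ) f(m,0)` for all finitely
supported `f`. -/
def IsOmega (α : ℝ) (μ : Measure Circle) (ω : NCTorus α →ₚ[ℂ] ℂ) : Prop :=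
  ∀ f : ℤ × ℤ →₀ ℂ,
    ω (NCTorus.W α f) = ∑' m : ℤ, (∫ z, ((z ^ m : Circle) : ℂ) ∂μ) * f (m, 0)

/-- `Φ` identifies the GNS space of `ω` with `⨁_n L²(𝕋, μ_n)` by sending `π_ω(W(f)) ξ_ω` to the
vector whose `n`-th component is `z ↦ ∑_m f(m,n) z^m`. -/
def IsGNSModel {α : ℝ} (μ : Measure Circle) (ω : NCTorus α →ₚ[ℂ] ℂ)
    (Φ : ω.GNS ≃ₗᵢ[ℂ] rotHilbert α μ) : Prop :=
  ∀ (f : ℤ × ℤ →₀ ℂ) (n : ℤ),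
    Φ (ω.gnsStarAlgHom (NCTorus.W α f) (gnsVector ω)) n =ᵐ[rotMeasure α μ n] rowTransform f n

end

noncomputable section

/-! ### Unbounded self-adjoint operators -/

section SelfAdjoint

variable {H : Type*} [NormedAddCommGroup H] [InnerProductSpace ℂ H] [CompleteSpace H]

/-! Since `W(a)⋆ = W(-a)`, the Tomita involution acts on trigonometric vectors by `(S x)_n =
conj(x_{-n})`. The relation `dμ_{-n} = h_n dμ_n` makes `(J x)_n = h_n^{1/2} conj(x_{-n})` isometric,
and `h_n h_{-n} = 1` almost everywhere gives `J² = 1`; hence `J S` is multiplication by `√h_n`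
(`rotInvolution_iff`). This multiplication is positive and self-adjoint on its maximal domain, so
its graph is closed.

It remains to see that trigonometric polynomials form a core (`mulGraph_le_closure_span_trigVec`).
If `(x, √h x)` is orthogonal in the graph to every `(e, √h e)`, `e` trigonometric, then all Fourier
coefficients of `x_n` with respect to `μ_n + μ_{-n}` vanish, and `x_n = 0` by Stone–Weierstrass.

Any other modular pair coincides with this one (`IsPolarDecomposition.unique`). Two positive parts
`T`, `T'` satisfy `T' = V T` with `V` unitary, so their squares agree. Positive square roots are
unique, by reduction through `R = (1 + Δ)⁻¹` to bounded operators; and `V = 1` because an injective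
self-adjoint operator has dense range.

The GNS space is made concrete by two weighted shifts on `⨁_n L²(𝕋, μ_n)` (`exists_torusRep`): `ω_μ`
is the vector functional of the constant function `1` in position `0`, a cyclic vector. -/

theorem LinearPMap.isSelfAdjoint_iff_graph {T : H →ₗ.[ℂ] H} (hT : Dense (T.domain : Set H)) :
    IsSelfAdjoint T ↔
      ∀ x y, (x, y) ∈ T.graph ↔ ∀ a b, (a, b) ∈ T.graph → ⟪b, x⟫_ℂ = ⟪a, y⟫_ℂ := by
  have key : ∀ x y, (x, y) ∈ T.adjoint.graph ↔
      ∀ a b, (a, b) ∈ T.graph → ⟪b, x⟫_ℂ = ⟪a, y⟫_ℂ := fun x y => by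
    rw [LinearPMap.adjoint_graph_eq_graph_adjoint hT, Submodule.mem_adjoint_iff]
    simp only [sub_eq_zero]
  rw [LinearPMap.isSelfAdjoint_def]
  constructor
  · intro h x y
    rw [← key, h]
  · intro h
    refine LinearPMap.eq_of_eq_graph ?_
    ext ⟨x, y⟩
    rw [key, h]

theorem IsSelfAdjoint.mem_graph_iff {T : H →ₗ.[ℂ] H} (hT : IsSelfAdjoint T) {x y : H} :
    (x, y) ∈ T.graph ↔ ∀ a b, (a, b) ∈ T.graph → ⟪b, x⟫_ℂ = ⟪a, y⟫_ℂ :=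
  (LinearPMap.isSelfAdjoint_iff_graph hT.dense_domain).1 hT x y

theorem IsSelfAdjoint.inner_graph_comm {T : H →ₗ.[ℂ] H} (hT : IsSelfAdjoint T) {x y a b : H}
    (h : (x, y) ∈ T.graph) (h' : (a, b) ∈ T.graph) : ⟪b, x⟫_ℂ = ⟪a, y⟫_ℂ :=
  hT.mem_graph_iff.1 h a b h'

/-- If `R = (1 + B²)⁻¹` for a positive self-adjoint `B`, then `B R` is a bounded positive operator
with square `R - R²`, and `R B ⊆ B R`. -/
theorem LinearPMap.exists_mul_resolvent {B Δ : H →ₗ.[ℂ] H}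
    (hB : ∀ x : B.domain, 0 ≤ ⟪(x : H), B x⟫_ℂ) (hΔ : IsOperatorSquare Δ B) (R : H →ₗ[ℂ] H)
    (hR : ∀ x, (R x, x - R x) ∈ Δ.graph) (hR' : ∀ x y, (x, y) ∈ Δ.graph → R (x + y) = x) :
    ∃ P : H →L[ℂ] H, 0 ≤ P ∧ (∀ x, P (P x) = R x - R (R x)) ∧
      ∀ x y, (x, y) ∈ B.graph → R y = P x := by
  have hpos : ∀ x y, (x, y) ∈ B.graph → 0 ≤ ⟪x, y⟫_ℂ := by
    intro x y hxy
    obtain ⟨u, rfl, rfl⟩ := (LinearPMap.mem_graph_iff B).1 hxy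
    exact hB u
  -- Here `p x = B R x` and `B (p x) = x - R x`.
  choose p hp hp' using fun x => (hΔ _ _).1 (hR x)
  -- With `y = B x`, subtraction gives `B (x - R x) = y - p x`, so `Δ (p x) = y - p x` and `p x = R
  -- y`.
  have hcomm : ∀ x y, (x, y) ∈ B.graph → R y = p x := by
    intro x y hxy
    have h1 : (x - R x, y - p x) ∈ B.graph := B.graph.sub_mem hxy (hp x)
    simpa using hR' (p x) (y - p x) ((hΔ _ _).2 ⟨_, hp' x, h1⟩)
  let P₀ : H →ₗ[ℂ] H :=
    { toFun := p
      map_add' := fun x y => by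
        have h := B.graph.add_mem (hp x) (hp y)
        exact LinearPMap.mem_graph_snd_inj B (hp (x + y)) h (R.map_add x y)
      map_smul' := fun c x => by
        have h := B.graph.smul_mem c (hp x)
        exact LinearPMap.mem_graph_snd_inj B (hp (c • x)) h (R.map_smul c x) }
  -- Split `x = R x + B (p x)`: both terms are values of the quadratic form of `B`, up to
  -- conjugation.
  have hP₀ : ∀ x, 0 ≤ ⟪p x, x⟫_ℂ := by
    intro x
    have h1 : 0 ≤ ⟪p x, R x⟫_ℂ := by
      have h := hpos _ _ (hp x)
      rw [← inner_conj_symm]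
      exact (star_nonneg_iff (R := ℂ)).2 h
    have h2 := hpos _ _ (hp' x)
    have h3 : ⟪p x, x⟫_ℂ = ⟪p x, R x⟫_ℂ + ⟪p x, x - R x⟫_ℂ := by
      rw [← inner_add_right]; simp
    rw [h3]
    exact add_nonneg h1 h2
  have hP₀' : P₀.IsPositive := by
    rw [LinearMap.isPositive_iff_complex]
    intro x
    have h := hP₀ x
    exact ⟨(Complex.eq_re_of_ofReal_le (r := 0) (by rw [Complex.ofReal_zero]; exact h)).symm, (Complex.nonneg_iff.1 h).1⟩
  -- Boundedness is Hellinger–Toeplitz: an everywhere defined symmetric operator is continuous.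
  refine ⟨⟨P₀, hP₀'.isSymmetric.continuous⟩, ?_, fun x => ?_, hcomm⟩
  · rw [ContinuousLinearMap.nonneg_iff_isPositive, ← ContinuousLinearMap.isPositive_toLinearMap_iff]
    exact hP₀'
  · change p (p x) = _
    rw [← hcomm _ _ (hp' x), R.map_sub]

/-- `hR` is surjectivity of `1 + Δ`. Injectivity holds because `Δ x = -x` forces `‖A x‖² = ⟪x, Δ x⟫
= -‖x‖²`. -/
theorem LinearPMap.exists_resolvent_square {A Δ : H →ₗ.[ℂ] H} (hA : IsSelfAdjoint A)
    (hΔ : IsOperatorSquare Δ A) (hR : ∀ x, ∃ y, (y, x - y) ∈ Δ.graph) :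
    ∃ R : H →ₗ[ℂ] H, (∀ x, (R x, x - R x) ∈ Δ.graph) ∧
      ∀ x y, (x, y) ∈ Δ.graph → R (x + y) = x := by
  have h0 : ∀ x y, (x, y) ∈ Δ.graph → x + y = 0 → x = 0 := by
    intro x y hxy hs
    obtain ⟨z, hz, hz'⟩ := (hΔ _ _).1 hxy
    have h1 : ⟪z, z⟫_ℂ = ⟪x, y⟫_ℂ := hA.inner_graph_comm hz' hz
    rw [eq_neg_of_add_eq_zero_right hs, inner_neg_right, inner_self_eq_norm_sq_to_K,
      inner_self_eq_norm_sq_to_K] at h1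
    have h2 : ‖z‖ ^ 2 = -‖x‖ ^ 2 := by exact_mod_cast h1
    have h3 : ‖x‖ ^ 2 = 0 := by nlinarith [sq_nonneg ‖z‖, sq_nonneg ‖x‖]
    simpa using h3
  have huniq : ∀ x y x' y', (x, y) ∈ Δ.graph → (x', y') ∈ Δ.graph → x + y = x' + y' → x = x' := by
    intro x y x' y' h h' hs
    have := h0 _ _ (Δ.graph.sub_mem h h') (by
      change x - x' + (y - y') = 0
      rw [sub_add_sub_comm, hs, sub_self])
    exact sub_eq_zero.1 this
  choose r hr using hR
  refine ⟨{ toFun := r, map_add' := fun x y => ?_, map_smul' := fun c x => ?_ }, hr,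
    fun x y hxy => huniq _ _ _ _ (hr _) hxy (by simp)⟩
  · exact huniq _ _ _ _ (hr _) (Δ.graph.add_mem (hr x) (hr y)) (by simp; abel)
  · exact huniq _ _ _ _ (hr _) (Δ.graph.smul_mem c (hr x)) (by simp [smul_sub])

/-- Positive self-adjoint square roots are unique. -/
theorem IsOperatorSquare.eq_of_mem_graph {A B Δ : H →ₗ.[ℂ] H} (hA : IsSelfAdjoint A)
    (hA0 : ∀ x : A.domain, 0 ≤ ⟪(x : H), A x⟫_ℂ) (hB0 : ∀ x : B.domain, 0 ≤ ⟪(x : H), B x⟫_ℂ)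
    (hΔA : IsOperatorSquare Δ A) (hΔB : IsOperatorSquare Δ B)
    (hR : ∀ x, ∃ y, (y, x - y) ∈ Δ.graph) {x y z : H} (hy : (x, y) ∈ A.graph)
    (hz : (x, z) ∈ B.graph) : y = z := by
  obtain ⟨R, h1, h2⟩ := LinearPMap.exists_resolvent_square hA hΔA hR
  obtain ⟨P, hP, hPP, hP'⟩ := LinearPMap.exists_mul_resolvent hA0 hΔA R h1 h2
  obtain ⟨Q, hQ, hQQ, hQ'⟩ := LinearPMap.exists_mul_resolvent hB0 hΔB R h1 h2
  -- Both are positive square roots of the bounded operator `R - R²`.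
  have hPQ : P = Q := by
    rw [← CFC.mul_self_eq_mul_self_iff P Q hP hQ]
    ext x
    exact (hPP x).trans (hQQ x).symm
  have h3 : R (y - z) = 0 := by rw [map_sub, hP' _ _ hy, hQ' _ _ hz, hPQ, sub_self]
  have h4 := h1 (y - z)
  rw [h3, sub_zero] at h4
  exact sub_eq_zero.1 (LinearPMap.graph_fst_eq_zero_snd Δ h4 rfl)

/-! ### Uniqueness of the polar decomposition. -/

theorem IsPolarDecomposition.mem_iff {S : Set (H × H)} {J : H ≃ₗᵢ⋆[ℂ] H} {T : H →ₗ.[ℂ] H}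
    (h : IsPolarDecomposition S J T) {x y : H} : (x, J y) ∈ S ↔ (x, y) ∈ T.graph := by
  rw [h.graph_eq, LinearPMap.mem_graph_iff]
  constructor
  · rintro ⟨hx, hy⟩
    exact ⟨⟨x, hx⟩, rfl, J.injective hy⟩
  · rintro ⟨⟨u, hu⟩, rfl, hy⟩
    exact ⟨hu, congrArg J hy⟩

/-- With `V = J'⁻¹ J` unitary and `T' = V T`, self-adjointness of `T'` gives formally `T'² = T'⋆ T'
= T V⋆ V T = T²`. -/
theorem IsPolarDecomposition.square_le {S : Set (H × H)} {J J' : H ≃ₗᵢ⋆[ℂ] H}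
    {T T' : H →ₗ.[ℂ] H} (h : IsPolarDecomposition S J T) (h' : IsPolarDecomposition S J' T')
    {x y : H} (hxy : ∃ z, (x, z) ∈ T.graph ∧ (z, y) ∈ T.graph) :
    ∃ z, (x, z) ∈ T'.graph ∧ (z, y) ∈ T'.graph := by
  let V : H ≃ₗᵢ[ℂ] H := J.trans J'.symm
  have hV : ∀ x y, (x, y) ∈ T.graph ↔ (x, V y) ∈ T'.graph := fun x y => by
    rw [← h.mem_iff, ← h'.mem_iff]
    simp [V]
  obtain ⟨z, hz, hzy⟩ := hxy
  refine ⟨V z, (hV _ _).1 hz, h'.isSelfAdjoint.mem_graph_iff.2 fun a b hab => ?_⟩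
  have hab' : (a, V.symm b) ∈ T.graph := by rw [hV]; simpa using hab
  rw [← h.isSelfAdjoint.inner_graph_comm hzy hab', ← V.inner_map_map (V.symm b) z,
    V.apply_symm_apply]

theorem IsPolarDecomposition.isOperatorSquare {S : Set (H × H)} {J J' : H ≃ₗᵢ⋆[ℂ] H}
    {T T' Δ : H →ₗ.[ℂ] H} (h : IsPolarDecomposition S J T) (h' : IsPolarDecomposition S J' T')
    (hΔ : IsOperatorSquare Δ T) : IsOperatorSquare Δ T' := fun x y =>
  (hΔ x y).trans ⟨h.square_le h', h'.square_le h⟩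

/-- Uniqueness of the polar decomposition and of the square of its positive part. -/
theorem IsPolarDecomposition.unique {S : Set (H × H)} {J J' : H ≃ₗᵢ⋆[ℂ] H}
    {T T' Δ Δ' : H →ₗ.[ℂ] H} (h : IsPolarDecomposition S J T) (h' : IsPolarDecomposition S J' T')
    (hΔ : IsOperatorSquare Δ T) (hΔ' : IsOperatorSquare Δ' T')
    (hR : ∀ x, ∃ y, (y, x - y) ∈ Δ'.graph) (hT' : ∀ x, (x, 0) ∈ T'.graph → x = 0) :
    Δ = Δ' ∧ J = J' := by
  have hΔT' := h.isOperatorSquare h' hΔ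
  have hΔΔ' : Δ = Δ' := LinearPMap.eq_of_eq_graph (by
    ext ⟨x, y⟩
    exact (hΔT' x y).trans (hΔ' x y).symm)
  refine ⟨hΔΔ', ?_⟩
  subst hΔΔ'
  let V : H ≃ₗᵢ[ℂ] H := J.trans J'.symm
  have hV : ∀ x y, (x, y) ∈ T.graph ↔ (x, V y) ∈ T'.graph := fun x y => by
    rw [← h.mem_iff, ← h'.mem_iff]
    simp [V]
  -- `T` and `T'` are square roots of the same `Δ`, so `V` fixes the range of `T'`.
  have hfix : ∀ x y, (x, y) ∈ T'.graph → V y = y := fun x y hxy => by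
    have h1 : (x, V.symm y) ∈ T.graph := by rw [hV]; simpa using hxy
    have h2 : y = V.symm y := IsOperatorSquare.eq_of_mem_graph h'.isSelfAdjoint h'.nonneg h.nonneg
      hΔT' hΔ hR hxy h1
    nth_rw 1 [h2]
    simp
  -- `V⁻¹ w - w` is orthogonal to the range of `T'`, hence lies in its kernel, which is trivial.
  have hzero : ∀ w, V w - w = 0 := fun w => by
    have h1 : (V.symm w - w, (0 : H)) ∈ T'.graph := by
      rw [h'.isSelfAdjoint.mem_graph_iff]
      intro a b hab
      rw [inner_zero_right, inner_sub_right, ← V.inner_map_map, hfix a b hab, V.apply_symm_apply,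
        sub_self]
    have h2 := sub_eq_zero.1 (hT' _ h1)
    rw [sub_eq_zero]
    nth_rw 1 [← h2]
    simp
  ext w
  have h3 := congrArg J' (sub_eq_zero.1 (hzero w))
  simpa [V] using h3

end SelfAdjoint

/-! ### Multiplication operators on Hilbert sums of `L²` spaces -/

section Multiplication

variable {ι X : Type*} [MeasurableSpace X] {ν : ι → Measure X}

theorem enorm_sq_eq_lintegral {m : Measure X} (f : Lp ℂ 2 m) :
    ENNReal.ofReal (‖f‖ ^ 2) = ∫⁻ z, ‖f z‖ₑ ^ 2 ∂m := by
  rw [ENNReal.ofReal_pow (norm_nonneg _), ofReal_norm, Lp.enorm_def]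
  have := eLpNorm_nnreal_pow_eq_lintegral (f := f) (μ := m) (p := 2) two_ne_zero
  simpa using this

theorem lp_two_norm_sq (x : lp (fun i => Lp ℂ 2 (ν i)) 2) :
    ENNReal.ofReal (‖x‖ ^ 2) = ∑' i, ∫⁻ z, ‖x i z‖ₑ ^ 2 ∂(ν i) := by
  have h := lp.hasSum_norm (p := 2) (by norm_num) x
  simp only [ENNReal.toReal_ofNat, Real.rpow_ofNat] at h
  rw [← h.tsum_eq, ENNReal.ofReal_tsum_of_nonneg (fun i => by positivity) h.summable]
  simp only [enorm_sq_eq_lintegral]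

/-- Reduces every domain question for multiplication operators to finiteness of a sum of integrals.
-/
theorem exists_lp_two_iff {f : ι → X → ℂ} (hf : ∀ i, AEStronglyMeasurable (f i) (ν i)) :
    (∃ y : lp (fun i => Lp ℂ 2 (ν i)) 2, ∀ i, y i =ᵐ[ν i] f i) ↔
      ∑' i, ∫⁻ z, ‖f i z‖ₑ ^ 2 ∂(ν i) < ∞ := by
  constructor
  · rintro ⟨y, hy⟩
    have : ∑' i, ∫⁻ z, ‖f i z‖ₑ ^ 2 ∂(ν i) = ∑' i, ∫⁻ z, ‖y i z‖ₑ ^ 2 ∂(ν i) := by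
      congr 1 with i
      exact lintegral_congr_ae ((hy i).mono fun z hz => by simp only [hz])
    rw [this, ← lp_two_norm_sq]
    exact ENNReal.ofReal_lt_top
  · intro h
    have hi : ∀ i, MemLp (f i) 2 (ν i) := fun i => by
      refine ⟨hf i, ?_⟩
      rw [eLpNorm_lt_top_iff_lintegral_rpow_enorm_lt_top two_ne_zero ENNReal.ofNat_ne_top]
      simpa using (ENNReal.le_tsum i).trans_lt h
    have hs : Memℓp (fun i => (hi i).toLp (f i)) 2 := by
      rw [memℓp_gen_iff (by norm_num)]
      have h2 : ∑' i, ENNReal.ofReal (‖(hi i).toLp (f i)‖ ^ 2) ≠ ∞ := by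
        simp only [enorm_sq_eq_lintegral]
        convert h.ne using 3 with i
        exact lintegral_congr_ae ((hi i).coeFn_toLp.mono fun z hz => by simp only [hz])
      have h3 := ENNReal.summable_toReal h2
      simpa [ENNReal.toReal_ofReal] using h3
    exact ⟨⟨_, hs⟩, fun i => (hi i).coeFn_toLp⟩

theorem exists_lp_two_of_le {f : ι → X → ℂ} (hf : ∀ i, AEStronglyMeasurable (f i) (ν i))
    (x y : lp (fun i => Lp ℂ 2 (ν i)) 2)
    (h : ∀ i, ∀ᵐ z ∂(ν i), ‖f i z‖ ^ 2 ≤ ‖x i z‖ ^ 2 + ‖y i z‖ ^ 2) :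
    ∃ w : lp (fun i => Lp ℂ 2 (ν i)) 2, ∀ i, w i =ᵐ[ν i] f i := by
  rw [exists_lp_two_iff hf]
  have h1 : ∑' i, ∫⁻ z, ‖f i z‖ₑ ^ 2 ∂(ν i) ≤
      ∑' i, (∫⁻ z, ‖x i z‖ₑ ^ 2 ∂(ν i) + ∫⁻ z, ‖y i z‖ₑ ^ 2 ∂(ν i)) := by
    refine ENNReal.tsum_le_tsum fun i => ?_
    rw [← lintegral_add_left' ((Lp.aestronglyMeasurable (x i)).enorm.pow_const 2)]
    refine lintegral_mono_ae ((h i).mono fun z hz => ?_)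
    simp only [← ofReal_norm, ← ENNReal.ofReal_pow (norm_nonneg _)]
    rw [← ENNReal.ofReal_add (by positivity) (by positivity)]
    exact ENNReal.ofReal_le_ofReal hz
  refine h1.trans_lt ?_
  rw [ENNReal.tsum_add, ← lp_two_norm_sq, ← lp_two_norm_sq]
  exact ENNReal.add_lt_top.2 ⟨ENNReal.ofReal_lt_top, ENNReal.ofReal_lt_top⟩

theorem lp_two_ext {x y : lp (fun i => Lp ℂ 2 (ν i)) 2} (h : ∀ i, x i =ᵐ[ν i] y i) : x = y :=
  lp.ext (funext fun i => Lp.ext (h i))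

/-- The graph of the operator of multiplication by a family of real functions. -/
def mulGraph (ν : ι → Measure X) (g : ι → X → ℝ) :
    Submodule ℂ (lp (fun i => Lp ℂ 2 (ν i)) 2 × lp (fun i => Lp ℂ 2 (ν i)) 2) where
  carrier := {p | ∀ i, p.2 i =ᵐ[ν i] fun z => (g i z : ℂ) * p.1 i z}
  add_mem' {p q} hp hq i := by
    filter_upwards [hp i, hq i, Lp.coeFn_add (p.1 i) (q.1 i), Lp.coeFn_add (p.2 i) (q.2 i)]
      with z h1 h2 h3 h4
    simp only [Prod.snd_add, Prod.fst_add, lp.coeFn_add, Pi.add_apply] at h3 h4 ⊢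
    rw [h3, h4, h1, h2, mul_add]
  zero_mem' i := by
    filter_upwards [Lp.coeFn_zero ℂ 2 (ν i)] with z h
    simp only [Prod.snd_zero, Prod.fst_zero, lp.coeFn_zero, Pi.zero_apply] at h ⊢
    rw [h, mul_zero]
  smul_mem' c p hp i := by
    filter_upwards [hp i, Lp.coeFn_smul c (p.1 i), Lp.coeFn_smul c (p.2 i)] with z h1 h3 h4
    simp only [Prod.smul_snd, Prod.smul_fst, lp.coeFn_smul, Pi.smul_apply, smul_eq_mul] at h3 h4 ⊢
    rw [h3, h4, h1, mul_left_comm]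

theorem mem_mulGraph {g : ι → X → ℝ} {x y : lp (fun i => Lp ℂ 2 (ν i)) 2} :
    (x, y) ∈ mulGraph ν g ↔ ∀ i, y i =ᵐ[ν i] fun z => (g i z : ℂ) * x i z := Iff.rfl

theorem eq_zero_of_mem_mulGraph {g : ι → X → ℝ} {y : lp (fun i => Lp ℂ 2 (ν i)) 2}
    (h : (0, y) ∈ mulGraph ν g) : y = 0 := lp_two_ext fun i => by
  filter_upwards [h i, Lp.coeFn_zero ℂ 2 (ν i)] with z h3 h4
  simp only [lp.coeFn_zero, Pi.zero_apply] at h3 h4 ⊢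
  rw [h3, h4, mul_zero]

theorem exists_mulGraph_of_le {g : ι → X → ℝ} (hg : ∀ i, Measurable (g i))
    (x y : lp (fun i => Lp ℂ 2 (ν i)) 2)
    (h : ∀ i, ∀ᵐ z ∂(ν i), ‖(g i z : ℂ) * x i z‖ ^ 2 ≤ ‖x i z‖ ^ 2 + ‖y i z‖ ^ 2) :
    ∃ w, (x, w) ∈ mulGraph ν g :=
  exists_lp_two_of_le (fun i => (Complex.measurable_ofReal.comp (hg i)).aestronglyMeasurable.mul
    (Lp.aestronglyMeasurable (x i))) x y h

theorem exists_mulGraph_of_bounded {g : ι → X → ℝ} (hg : ∀ i, Measurable (g i))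
    (hb : ∀ i z, |g i z| ≤ 1) (x : lp (fun i => Lp ℂ 2 (ν i)) 2) : ∃ w, (x, w) ∈ mulGraph ν g := by
  refine exists_mulGraph_of_le hg x 0 fun i => Filter.Eventually.of_forall fun z => ?_
  rw [norm_mul, Complex.norm_real, mul_pow, Real.norm_eq_abs, sq_abs]
  have h1 : g i z ^ 2 ≤ 1 := (sq_le_one_iff_abs_le_one _).2 (hb i z)
  nlinarith [sq_nonneg ‖x i z‖, sq_nonneg ‖(0 : lp (fun i => Lp ℂ 2 (ν i)) 2) i z‖]

theorem inner_lp_two_congr {x y a b : lp (fun i => Lp ℂ 2 (ν i)) 2}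
    (h : ∀ i, ∀ᵐ z ∂(ν i), conj (x i z) * y i z = conj (a i z) * b i z) : ⟪x, y⟫_ℂ = ⟪a, b⟫_ℂ := by
  rw [lp.inner_eq_tsum, lp.inner_eq_tsum]
  congr 1 with i
  rw [L2.inner_def, L2.inner_def]
  refine integral_congr_ae ((h i).mono fun z hz => ?_)
  simp only [RCLike.inner_apply']
  exact hz

theorem inner_mulGraph_comm {g : ι → X → ℝ} {x y a b : lp (fun i => Lp ℂ 2 (ν i)) 2}
    (h : (x, y) ∈ mulGraph ν g) (h' : (a, b) ∈ mulGraph ν g) : ⟪b, x⟫_ℂ = ⟪a, y⟫_ℂ := by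
  refine inner_lp_two_congr fun i => ?_
  filter_upwards [h i, h' i] with z h1 h2
  rw [h1, h2, map_mul, Complex.conj_ofReal]
  ring

/-- The point is that `√h x` is square-summable when `x` and `h x` are, since `h ≤ 1 + h²`. -/
theorem mulGraph_sqrt_iff {h : ι → X → ℝ} (hm : ∀ i, Measurable (h i)) (h0 : ∀ i z, 0 ≤ h i z)
    {x y : lp (fun i => Lp ℂ 2 (ν i)) 2} : (x, y) ∈ mulGraph ν h ↔
      ∃ w, (x, w) ∈ mulGraph ν (fun i z => √(h i z)) ∧
        (w, y) ∈ mulGraph ν (fun i z => √(h i z)) := by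
  have hs : ∀ i z, ((√(h i z) : ℝ) : ℂ) * (√(h i z) : ℝ) = h i z := fun i z => by
    rw [← Complex.ofReal_mul, Real.mul_self_sqrt (h0 i z)]
  constructor
  · intro hxy
    obtain ⟨w, hw⟩ := exists_mulGraph_of_le (g := fun i z => √(h i z))
      (fun i => (hm i).sqrt) x y fun i => by
        filter_upwards [hxy i] with z hz
        rw [hz, norm_mul, norm_mul, Complex.norm_real, Complex.norm_real, mul_pow, mul_pow,
          Real.norm_eq_abs, Real.norm_eq_abs, sq_abs, sq_abs, Real.sq_sqrt (h0 i z)]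
        nlinarith [sq_nonneg ‖x i z‖, mul_nonneg (sq_nonneg (h i z - 1)) (sq_nonneg ‖x i z‖),
          mul_nonneg (h0 i z) (sq_nonneg ‖x i z‖)]
    refine ⟨w, hw, fun i => ?_⟩
    filter_upwards [hxy i, hw i] with z h1 h2
    rw [h1, h2, ← mul_assoc, hs]
  · rintro ⟨w, hw, hy⟩ i
    filter_upwards [hw i, hy i] with z h1 h2
    rw [h2, h1, ← mul_assoc, hs]

theorem inner_mulGraph_nonneg {h : ι → X → ℝ} (hm : ∀ i, Measurable (h i)) (h0 : ∀ i z, 0 ≤ h i z)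
    {x y : lp (fun i => Lp ℂ 2 (ν i)) 2} (hxy : (x, y) ∈ mulGraph ν h) : 0 ≤ ⟪x, y⟫_ℂ := by
  obtain ⟨w, hw, hy⟩ := (mulGraph_sqrt_iff hm h0).1 hxy
  rw [← inner_mulGraph_comm hy hw, inner_self_eq_norm_sq_to_K]
  exact pow_nonneg (Complex.zero_le_real.2 (norm_nonneg w)) 2

/-- `(1 + h)⁻¹` is bounded by `1`, and `1 - (1 + h)⁻¹ = h (1 + h)⁻¹`. This resolvent replaces any
truncation argument below. -/
theorem exists_mulGraph_resolvent {h : ι → X → ℝ} (hm : ∀ i, Measurable (h i))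
    (h0 : ∀ i z, 0 ≤ h i z) (x : lp (fun i => Lp ℂ 2 (ν i)) 2) :
    ∃ y, (x, y) ∈ mulGraph ν (fun i z => (1 + h i z)⁻¹) ∧ (y, x - y) ∈ mulGraph ν h := by
  obtain ⟨y, hy⟩ := exists_mulGraph_of_bounded (ν := ν) (g := fun i z => (1 + h i z)⁻¹)
    (fun i => (measurable_const.add (hm i)).inv) (fun i z => by
      rw [abs_of_nonneg (inv_nonneg.2 (by linarith [h0 i z]))]
      exact inv_le_one_of_one_le₀ (by linarith [h0 i z])) x
  refine ⟨y, hy, fun i => ?_⟩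
  filter_upwards [hy i, Lp.coeFn_sub (x i) (y i)] with z h1 h2
  simp only [lp.coeFn_sub, Pi.sub_apply] at h1 h2 ⊢
  have h3 : (1 + h i z : ℂ) ≠ 0 := by
    have : (1 + h i z : ℝ) ≠ 0 := by linarith [h0 i z]
    exact_mod_cast this
  rw [h2, h1]
  push_cast
  field_simp
  ring

/-- The inclusion of the adjoint in the operator. Testing on the pairs `(R a, a - R a)`, `R = (1 +
h)⁻¹`, gives `x - R x = R y`; multiplying by `1 + h` pointwise yields `y = h x`. -/
theorem mem_mulGraph_of_inner {h : ι → X → ℝ} (hm : ∀ i, Measurable (h i))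
    (h0 : ∀ i z, 0 ≤ h i z) {x y : lp (fun i => Lp ℂ 2 (ν i)) 2}
    (hxy : ∀ a b, (a, b) ∈ mulGraph ν h → ⟪b, x⟫_ℂ = ⟪a, y⟫_ℂ) : (x, y) ∈ mulGraph ν h := by
  obtain ⟨x', hx', hx''⟩ := exists_mulGraph_resolvent hm h0 x
  obtain ⟨y', hy', hy''⟩ := exists_mulGraph_resolvent hm h0 y
  have hv : x - x' = y' := by
    refine ext_inner_left ℂ fun a => ?_
    obtain ⟨a', ha', ha''⟩ := exists_mulGraph_resolvent hm h0 a
    have h1 := hxy _ _ ha''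
    rw [← inner_mulGraph_comm hy' ha', ← h1, inner_sub_left, inner_sub_right,
      inner_mulGraph_comm hx' ha']
  intro i
  have hv' : x i - x' i = y' i := by rw [← hv]; rfl
  filter_upwards [hx' i, hy' i, Lp.coeFn_sub (x i) (x' i)] with z h1 h2 h3
  rw [hv'] at h3
  simp only [Pi.sub_apply] at h1 h2 h3
  rw [h1, h2] at h3
  have h4 : (1 + h i z : ℂ) ≠ 0 := by
    have : (1 + h i z : ℝ) ≠ 0 := by linarith [h0 i z]
    exact_mod_cast this
  push_cast at h3
  field_simp at h3
  simp only [h3]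
  ring

/-! ### Transport of multiplication operators to an isomorphic Hilbert space. -/

variable {G : Type*} [NormedAddCommGroup G] [InnerProductSpace ℂ G]

/-- The operator of multiplication by a family of real functions, with its maximal domain,
transported to a Hilbert space `G` by an isomorphism `Φ`. -/
def mulOp (Φ : G ≃ₗᵢ[ℂ] lp (fun i => Lp ℂ 2 (ν i)) 2) (g : ι → X → ℝ) : G →ₗ.[ℂ] G :=
  ((mulGraph ν g).comap
    ((Φ.toLinearEquiv.prodCongr Φ.toLinearEquiv : (G × G) ≃ₗ[ℂ] _) : (G × G) →ₗ[ℂ] _)).toLinearPMap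

variable {Φ : G ≃ₗᵢ[ℂ] lp (fun i => Lp ℂ 2 (ν i)) 2}

theorem mem_graph_mulOp {g : ι → X → ℝ} {x y : G} :
    (x, y) ∈ (mulOp Φ g).graph ↔ (Φ x, Φ y) ∈ mulGraph ν g := by
  rw [mulOp, Submodule.toLinearPMap_graph_eq]
  · rfl
  · rintro ⟨x, y⟩ h (rfl : x = 0)
    have h1 : (Φ 0, Φ y) ∈ mulGraph ν g := h
    rw [map_zero] at h1
    simpa using eq_zero_of_mem_mulGraph h1

theorem isSelfAdjoint_mulOp [CompleteSpace G] {h : ι → X → ℝ} (hm : ∀ i, Measurable (h i)) (h0 : ∀ i z, 0 ≤ h i z) :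
    IsSelfAdjoint (mulOp Φ h) := by
  -- The domain contains the range of the resolvent; a vector `x` orthogonal to it has resolvent
  -- `0`, so `(0, x)` is in the graph and `x = 0`.
  have hd : Dense ((mulOp Φ h).domain : Set G) := by
    rw [Submodule.dense_iff_topologicalClosure_eq_top, Submodule.topologicalClosure_eq_top_iff,
      Submodule.eq_bot_iff]
    intro x hx
    obtain ⟨x', hx', hx''⟩ := exists_mulGraph_resolvent hm h0 (Φ x)
    have h1 : ∀ a, ⟪a, x'⟫_ℂ = 0 := fun a => by
      obtain ⟨a', ha', ha''⟩ := exists_mulGraph_resolvent hm h0 a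
      have h2 : Φ.symm a' ∈ (mulOp Φ h).domain :=
        LinearPMap.mem_domain_of_mem_graph (y := Φ.symm (a - a'))
          (mem_graph_mulOp.2 (by simpa using ha''))
      have h3 := (Submodule.mem_orthogonal _ _).1 hx _ h2
      rwa [← Φ.inner_map_map, Φ.apply_symm_apply, inner_mulGraph_comm hx' ha'] at h3
    have h2 : x' = 0 := inner_self_eq_zero.1 (h1 x')
    rw [h2, sub_zero] at hx''
    have h3 := mem_graph_mulOp (Φ := Φ) (x := 0) (y := x) (g := h)
    rw [map_zero] at h3
    exact LinearPMap.graph_fst_eq_zero_snd _ (h3.2 hx'') rfl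
  rw [LinearPMap.isSelfAdjoint_iff_graph hd]
  intro x y
  constructor
  · intro hxy a b hab
    rw [mem_graph_mulOp] at hxy hab
    rw [← Φ.inner_map_map, inner_mulGraph_comm hxy hab, Φ.inner_map_map]
  · intro H
    refine mem_graph_mulOp.2 (mem_mulGraph_of_inner hm h0 fun a b hab => ?_)
    have h1 := H (Φ.symm a) (Φ.symm b) (mem_graph_mulOp.2 (by simpa using hab))
    rwa [← Φ.inner_map_map, ← Φ.inner_map_map (Φ.symm a), Φ.apply_symm_apply,
      Φ.apply_symm_apply] at h1

theorem isClosed_mulGraph {g : ι → X → ℝ} (hm : ∀ i, Measurable (g i)) (h0 : ∀ i z, 0 ≤ g i z) :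
    IsClosed (mulGraph ν g : Set (lp (fun i => Lp ℂ 2 (ν i)) 2 × lp (fun i => Lp ℂ 2 (ν i)) 2)) := by
  have h := (isSelfAdjoint_mulOp
    (Φ := LinearIsometryEquiv.refl ℂ (lp (fun i => Lp ℂ 2 (ν i)) 2)) hm h0).isClosed
  convert (show IsClosed _ from h) using 1
  ext ⟨x, y⟩
  exact (mem_graph_mulOp (Φ := LinearIsometryEquiv.refl ℂ (lp (fun i => Lp ℂ 2 (ν i)) 2))).symm

theorem mulOp_nonneg {h : ι → X → ℝ} (hm : ∀ i, Measurable (h i)) (h0 : ∀ i z, 0 ≤ h i z)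
    (x : (mulOp Φ h).domain) : 0 ≤ ⟪(x : G), mulOp Φ h x⟫_ℂ := by
  rw [← Φ.inner_map_map]
  exact inner_mulGraph_nonneg hm h0 (mem_graph_mulOp.1 (LinearPMap.mem_graph _ x))

theorem isOperatorSquare_mulOp {h : ι → X → ℝ} (hm : ∀ i, Measurable (h i))
    (h0 : ∀ i z, 0 ≤ h i z) :
    IsOperatorSquare (mulOp Φ h) (mulOp Φ fun i z => √(h i z)) := by
  intro x y
  rw [mem_graph_mulOp, mulGraph_sqrt_iff hm h0]
  constructor
  · rintro ⟨w, hw⟩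
    refine ⟨Φ.symm w, ?_⟩
    rw [mem_graph_mulOp, mem_graph_mulOp, Φ.apply_symm_apply]
    exact hw
  · rintro ⟨w, hw⟩
    rw [mem_graph_mulOp, mem_graph_mulOp] at hw
    exact ⟨Φ w, hw⟩

theorem exists_mulOp_resolvent {h : ι → X → ℝ} (hm : ∀ i, Measurable (h i))
    (h0 : ∀ i z, 0 ≤ h i z) (x : G) : ∃ y, (y, x - y) ∈ (mulOp Φ h).graph := by
  obtain ⟨y, -, hy⟩ := exists_mulGraph_resolvent hm h0 (Φ x)
  exact ⟨Φ.symm y, mem_graph_mulOp.2 (by simpa using hy)⟩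

theorem mem_domain_mulOp_iff {h : ι → X → ℝ} (hm : ∀ i, Measurable (h i)) (x : G) :
    x ∈ (mulOp Φ h).domain ↔ ∑' i, ∫⁻ z, ‖(h i z : ℂ) * Φ x i z‖ₑ ^ 2 ∂(ν i) < ∞ := by
  rw [← exists_lp_two_iff (f := fun i z => (h i z : ℂ) * Φ x i z) fun i =>
    (Complex.measurable_ofReal.comp (hm i)).aestronglyMeasurable.mul
      (Lp.aestronglyMeasurable (Φ x i)), LinearPMap.mem_domain_iff]
  constructor
  · rintro ⟨y, hy⟩
    exact ⟨Φ y, mem_graph_mulOp.1 hy⟩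
  · rintro ⟨y, hy⟩
    exact ⟨Φ.symm y, mem_graph_mulOp.2 (by simpa [mem_mulGraph] using hy)⟩

theorem mulOp_apply_ae {h : ι → X → ℝ} (x : (mulOp Φ h).domain) (i : ι) :
    Φ (mulOp Φ h x) i =ᵐ[ν i] fun z => (h i z : ℂ) * Φ x i z :=
  mem_graph_mulOp.1 (LinearPMap.mem_graph _ x) i

end Multiplication

/-! ### The modular data on `⨁_n L²(𝕋, μ_n)` -/

section Rotation

variable (α : ℝ) (μ : Measure Circle)

theorem measurable_rotation (n : ℤ) :
    Measurable fun z : Circle => Circle.exp (2 * Real.pi * α * n) * z :=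
  (continuous_const.mul continuous_id).measurable

instance [IsProbabilityMeasure μ] (n : ℤ) : IsProbabilityMeasure (rotMeasure α μ n) :=
  Measure.isProbabilityMeasure_map (measurable_rotation α n).aemeasurable

theorem rotMeasure_zero : rotMeasure α μ 0 = μ := by
  simp [rotMeasure]

theorem measurable_rotDensity (n : ℤ) : Measurable (rotDensity α μ n) :=
  (Measure.measurable_rnDeriv _ _).ennreal_toReal

theorem rotDensity_nonneg (n : ℤ) (z : Circle) : 0 ≤ rotDensity α μ n z := ENNReal.toReal_nonneg

variable {α μ} [IsProbabilityMeasure μ]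
  (hμ : ∀ n : ℤ, rotMeasure α μ (-n) ≪ rotMeasure α μ n ∧ rotMeasure α μ n ≪ rotMeasure α μ (-n))

include hμ

theorem rotDensity_mul_neg (n : ℤ) :
    ∀ᵐ z ∂(rotMeasure α μ n), rotDensity α μ n z * rotDensity α μ (-n) z = 1 := by
  -- Finiteness and positivity are needed because `toReal` sends both `0` and `∞` to `0`.
  filter_upwards [Measure.inv_rnDeriv (hμ n).2, (hμ n).2.ae_le
    (Measure.rnDeriv_lt_top (rotMeasure α μ n) (rotMeasure α μ (-n))),
    Measure.rnDeriv_pos (hμ n).2] with z h1 h2 h3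
  simp only [rotDensity, neg_neg, Pi.inv_apply] at h1 ⊢
  rw [← h1, ENNReal.toReal_inv]
  exact inv_mul_cancel₀ (ENNReal.toReal_pos h3.ne' h2.ne).ne'

theorem lintegral_rotDensity_mul (n : ℤ) {f : Circle → ℝ≥0∞} (hf : Measurable f) :
    ∫⁻ z, ENNReal.ofReal (rotDensity α μ n z) * f z ∂(rotMeasure α μ n) =
      ∫⁻ z, f z ∂(rotMeasure α μ (-n)) := by
  rw [← lintegral_rnDeriv_mul (hμ n).1 hf.aemeasurable]
  refine lintegral_congr_ae ?_
  filter_upwards [Measure.rnDeriv_lt_top (rotMeasure α μ (-n)) (rotMeasure α μ n)] with z hz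
  rw [rotDensity, ENNReal.ofReal_toReal hz.ne]

omit hμ [IsProbabilityMeasure μ] in
theorem measurable_lp_comp_neg (x : rotHilbert α μ) (n : ℤ) : Measurable (x n) :=
  (Lp.stronglyMeasurable (x n)).measurable

/-- The norm is kept because `∫ h_n |x_{-n}|² dμ_n = ∫ |x_{-n}|² dμ_{-n}`, followed by the
reindexing `n ↦ -n`. -/
theorem exists_rotConj (x : rotHilbert α μ) : ∃ y : rotHilbert α μ,
    (∀ n, y n =ᵐ[rotMeasure α μ n] fun z => (√(rotDensity α μ n z) : ℂ) * conj (x (-n) z)) ∧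
      ‖y‖ = ‖x‖ := by
  have hsum : ∑' n : ℤ, ∫⁻ z, ‖(√(rotDensity α μ n z) : ℂ) * conj (x (-n) z)‖ₑ ^ 2
      ∂(rotMeasure α μ n) = ENNReal.ofReal (‖x‖ ^ 2) := by
    rw [lp_two_norm_sq, ← (Equiv.neg ℤ).tsum_eq fun n =>
      ∫⁻ z, ‖x n z‖ₑ ^ 2 ∂(rotMeasure α μ n)]
    congr 1 with n
    rw [Equiv.neg_apply, ← lintegral_rotDensity_mul hμ n
      ((measurable_lp_comp_neg x (-n)).enorm.pow_const 2)]
    refine lintegral_congr fun z => ?_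
    rw [enorm_mul, mul_pow, ← ofReal_norm, Complex.norm_real, Real.norm_eq_abs,
      ← ENNReal.ofReal_pow (abs_nonneg _), sq_abs, Real.sq_sqrt (rotDensity_nonneg α μ n z),
      RCLike.enorm_conj]
  obtain ⟨y, hy⟩ := (exists_lp_two_iff (ν := rotMeasure α μ)
    (f := fun n z => (√(rotDensity α μ n z) : ℂ) * conj (x (-n) z)) (fun n =>
      ((Complex.measurable_ofReal.comp (measurable_rotDensity α μ n).sqrt).mul
        (Complex.continuous_conj.measurable.comp
          (measurable_lp_comp_neg x (-n)))).aestronglyMeasurable)).2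
    (by rw [hsum]; exact ENNReal.ofReal_lt_top)
  refine ⟨y, hy, ?_⟩
  have h1 : ENNReal.ofReal (‖y‖ ^ 2) = ENNReal.ofReal (‖x‖ ^ 2) := by
    rw [← hsum, lp_two_norm_sq]
    congr 1 with n
    exact lintegral_congr_ae ((hy n).mono fun z hz => by simp only [hz])
  rw [ENNReal.ofReal_eq_ofReal_iff (by positivity) (by positivity)] at h1
  exact (sq_eq_sq₀ (norm_nonneg _) (norm_nonneg _)).1 h1

theorem rotConj_symm {x y : rotHilbert α μ}
    (h : ∀ n, y n =ᵐ[rotMeasure α μ n] fun z => (√(rotDensity α μ n z) : ℂ) * conj (x (-n) z))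
    (n : ℤ) : x n =ᵐ[rotMeasure α μ n] fun z => (√(rotDensity α μ n z) : ℂ) * conj (y (-n) z) := by
  have h1 := h (-n)
  rw [neg_neg] at h1
  filter_upwards [(hμ n).2.ae_le h1, rotDensity_mul_neg hμ n] with z h2 h3
  rw [h2, map_mul, Complex.conj_ofReal, Complex.conj_conj, ← mul_assoc, ← Complex.ofReal_mul,
    ← Real.sqrt_mul (rotDensity_nonneg α μ n z), h3]
  simp

/-- The conjugation `(J x)_n = h_n^{1/2} conj(x_{-n})` of `⨁_n L²(𝕋, μ_n)`. -/
def rotConj : rotHilbert α μ ≃ₗᵢ⋆[ℂ] rotHilbert α μ where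
  toFun x := (exists_rotConj hμ x).choose
  map_add' x y := lp_two_ext fun n => by
    -- Identities for `x_{-n}` hold `μ_{-n}`-a.e.; `μ_n ≪ μ_{-n}` carries them over to `μ_n`.
    filter_upwards [(exists_rotConj hμ (x + y)).choose_spec.1 n,
      (exists_rotConj hμ x).choose_spec.1 n, (exists_rotConj hμ y).choose_spec.1 n,
      Lp.coeFn_add ((exists_rotConj hμ x).choose n) ((exists_rotConj hμ y).choose n),
      (hμ n).2.ae_le (Lp.coeFn_add (x (-n)) (y (-n)))] with z h1 h2 h3 h4 h5
    simp only [lp.coeFn_add, Pi.add_apply] at h1 h4 h5 ⊢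
    rw [h1, h4, h5, h2, h3, map_add, mul_add]
  map_smul' c x := lp_two_ext fun n => by
    filter_upwards [(exists_rotConj hμ (c • x)).choose_spec.1 n,
      (exists_rotConj hμ x).choose_spec.1 n,
      Lp.coeFn_smul (conj c) ((exists_rotConj hμ x).choose n),
      (hμ n).2.ae_le (Lp.coeFn_smul c (x (-n)))] with z h1 h2 h4 h5
    simp only [lp.coeFn_smul, Pi.smul_apply, smul_eq_mul] at h1 h4 h5 ⊢
    rw [h1, h4, h5, h2, map_mul, mul_left_comm]
  invFun x := (exists_rotConj hμ x).choose
  left_inv x := lp_two_ext fun n => by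
    filter_upwards [(exists_rotConj hμ (exists_rotConj hμ x).choose).choose_spec.1 n,
      rotConj_symm hμ (exists_rotConj hμ x).choose_spec.1 n] with z h1 h2
    rw [h1, h2]
  right_inv x := lp_two_ext fun n => by
    filter_upwards [(exists_rotConj hμ (exists_rotConj hμ x).choose).choose_spec.1 n,
      rotConj_symm hμ (exists_rotConj hμ x).choose_spec.1 n] with z h1 h2
    rw [h1, h2]
  norm_map' x := (exists_rotConj hμ x).choose_spec.2

theorem rotConj_ae (x : rotHilbert α μ) (n : ℤ) : rotConj hμ x n =ᵐ[rotMeasure α μ n]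
    fun z => (√(rotDensity α μ n z) : ℂ) * conj (x (-n) z) :=
  (exists_rotConj hμ x).choose_spec.1 n

theorem rotConj_rotConj (x : rotHilbert α μ) : rotConj hμ (rotConj hμ x) = x :=
  (rotConj hμ).symm_apply_apply x

/-- `(S x)_n = conj(x_{-n})` if and only if `S x = J Δ^{1/2} x`. -/
theorem rotInvolution_iff {x y : rotHilbert α μ} :
    (∀ n, y n =ᵐ[rotMeasure α μ n] fun z => conj (x (-n) z)) ↔
      (x, rotConj hμ y) ∈ mulGraph (rotMeasure α μ) fun n z => √(rotDensity α μ n z) := by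
  constructor
  · intro h n
    have h1 := h (-n)
    rw [neg_neg] at h1
    filter_upwards [rotConj_ae hμ y n, (hμ n).2.ae_le h1] with z h2 h3
    rw [h2, h3, Complex.conj_conj]
  · intro h n
    have h1 := h (-n)
    have h2 := rotConj_ae hμ (rotConj hμ y) n
    rw [rotConj_rotConj] at h2
    filter_upwards [h2, (hμ n).2.ae_le h1, rotDensity_mul_neg hμ n] with z h3 h4 h5
    rw [h3, h4, map_mul, Complex.conj_ofReal, ← mul_assoc, ← Complex.ofReal_mul,
      ← Real.sqrt_mul (rotDensity_nonneg α μ n z), h5]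
    simp

end Rotation

/-! ### Trigonometric polynomials -/

section Trigonometric

/-- The function `z ↦ z ^ m` on the circle. -/
def circlePow (m : ℤ) : C(Circle, ℂ) := 
  ⟨fun z => ((z ^ m : Circle) : ℂ), continuous_induced_dom.comp (continuous_zpow m)⟩

theorem circlePow_apply (m : ℤ) (z : Circle) : circlePow m z = ((z ^ m : Circle) : ℂ) := rfl

theorem conj_circlePow (m : ℤ) (z : Circle) : conj (circlePow m z) = circlePow (-m) z := by
  rw [circlePow_apply, circlePow_apply, zpow_neg, Circle.coe_inv_eq_conj]

/-- The star subalgebra of `C(𝕋, ℂ)` generated by the functions `z ↦ z ^ m`. -/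
def circlePowSubalgebra : StarSubalgebra ℂ C(Circle, ℂ) where
  toSubalgebra := Algebra.adjoin ℂ (Set.range circlePow)
  star_mem' := by
    change Algebra.adjoin ℂ (Set.range circlePow) ≤ star (Algebra.adjoin ℂ (Set.range circlePow))
    refine Algebra.adjoin_le ?_
    rintro - ⟨n, rfl⟩
    exact Algebra.subset_adjoin ⟨-n, ContinuousMap.ext fun z => (conj_circlePow n z).symm⟩

theorem circlePowSubalgebra_coe : Subalgebra.toSubmodule circlePowSubalgebra.toSubalgebra =
    Submodule.span ℂ (Set.range circlePow) := by
  apply Algebra.adjoin_eq_span_of_subset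
  refine Set.Subset.trans ?_ Submodule.subset_span
  intro x hx
  refine Submonoid.closure_induction (fun _ => id) ⟨0, ?_⟩ ?_ hx
  · ext1 z
    simp [circlePow_apply]
  · rintro - - - - ⟨m, rfl⟩ ⟨n, rfl⟩
    refine ⟨m + n, ?_⟩
    ext1 z
    simp [circlePow_apply, zpow_add]

/-- Stone–Weierstrass; `circlePow 1` already separates points. -/
theorem span_circlePow_closure_eq_top :
    (Submodule.span ℂ (Set.range circlePow)).topologicalClosure = ⊤ := by
  have h : circlePowSubalgebra.topologicalClosure = ⊤ := by
    refine ContinuousMap.starSubalgebra_topologicalClosure_eq_top_of_separatesPoints _ ?_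
    intro x y hxy
    refine ⟨_, ⟨circlePow 1, Algebra.subset_adjoin ⟨1, rfl⟩, rfl⟩, ?_⟩
    simpa [circlePow_apply] using fun h => hxy (Circle.ext h)
  rw [← circlePowSubalgebra_coe]
  exact congr_arg (Subalgebra.toSubmodule <| StarSubalgebra.toSubalgebra ·) h

/-- The function `z ↦ z ^ m` as an element of `L²`. -/
def circlePowLp (ρ : Measure Circle) [IsFiniteMeasure ρ] (m : ℤ) : Lp ℂ 2 ρ :=
  ContinuousMap.toLp 2 ρ ℂ (circlePow m)

variable {ρ : Measure Circle} [IsFiniteMeasure ρ]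

theorem coeFn_circlePowLp (m : ℤ) : circlePowLp ρ m =ᵐ[ρ] circlePow m :=
  ContinuousMap.coeFn_toLp ρ (circlePow m)

theorem inner_circlePowLp (m : ℤ) (u : Lp ℂ 2 ρ) :
    ⟪circlePowLp ρ m, u⟫_ℂ = ∫ z, conj (circlePow m z) * u z ∂ρ := by
  rw [L2.inner_def]
  refine integral_congr_ae ((coeFn_circlePowLp m).mono fun z hz => ?_)
  simp only [RCLike.inner_apply']
  rw [hz]

/-- Characters are uniformly dense in `C(𝕋)`, which is dense in `L²(ρ)` for every finite Borel
measure `ρ`; they need not be orthogonal. -/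
theorem eq_zero_of_inner_circlePowLp {u : Lp ℂ 2 ρ} (h : ∀ m, ⟪circlePowLp ρ m, u⟫_ℂ = 0) :
    u = 0 := by
  have hd := (ContinuousMap.toLp_denseRange (p := 2) ℂ ρ ℂ
    ENNReal.ofNat_ne_top).topologicalClosure_map_submodule span_circlePow_closure_eq_top
  have h1 : u ∈ (Submodule.span ℂ (Set.range (circlePowLp ρ)))ᗮ := by
    rw [Submodule.mem_orthogonal]
    intro v hv
    induction hv using Submodule.span_induction with
    | mem v hv => obtain ⟨m, rfl⟩ := hv; exact h m
    | zero => exact inner_zero_left _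
    | add v w _ _ hv hw => rw [inner_add_left, hv, hw, add_zero]
    | smul c v _ hv => rw [inner_smul_left, hv, mul_zero]
  have h2 : (Submodule.span ℂ (Set.range (circlePowLp ρ))).topologicalClosure = ⊤ := by
    rw [Submodule.map_span, ← Set.range_comp] at hd
    exact hd
  rw [Submodule.topologicalClosure_eq_top_iff] at h2
  rw [h2] at h1
  exact h1

theorem ae_eq_zero_of_integral_circlePow {u : Circle → ℂ} (hu : MemLp u 2 ρ)
    (h : ∀ m, ∫ z, conj (circlePow m z) * u z ∂ρ = 0) : u =ᵐ[ρ] 0 := by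
  have h1 : hu.toLp u = 0 := eq_zero_of_inner_circlePowLp fun m => by
    rw [inner_circlePowLp, ← h m]
    exact integral_congr_ae (hu.coeFn_toLp.mono fun z hz => by simp only [hz])
  filter_upwards [hu.coeFn_toLp, Lp.eq_zero_iff_ae_eq_zero.1 h1] with z h2 h3
  rw [← h2, h3]

/-! ### Trigonometric vectors, a total family in the Hilbert sum. -/

variable (α : ℝ) (μ : Measure Circle) [IsProbabilityMeasure μ]

/-- The vector of `⨁_n L²(𝕋, μ_n)` with the only component `z ↦ z ^ m`, in position `n`. -/
def trigVec (a : ℤ × ℤ) : rotHilbert α μ := lp.single 2 a.2 (circlePowLp (rotMeasure α μ a.2) a.1)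

variable {α μ}

theorem trigVec_ae (a : ℤ × ℤ) (n : ℤ) : trigVec α μ a n =ᵐ[rotMeasure α μ n]
    fun z => if n = a.2 then circlePow a.1 z else 0 := by
  by_cases h : n = a.2
  · subst h
    simp only [trigVec, lp.single_apply_self, if_true]
    exact coeFn_circlePowLp _
  · simp only [trigVec, lp.single_apply_ne _ _ _ h, h, if_false]
    exact Lp.coeFn_zero _ _ _

theorem inner_trigVec (a : ℤ × ℤ) (x : rotHilbert α μ) : ⟪trigVec α μ a, x⟫_ℂ =
    ∫ z, conj (circlePow a.1 z) * x a.2 z ∂(rotMeasure α μ a.2) := by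
  rw [trigVec, lp.inner_single_left, inner_circlePowLp]

theorem inner_trigVec_trigVec (a b : ℤ × ℤ) : ⟪trigVec α μ a, trigVec α μ b⟫_ℂ =
    if a.2 = b.2 then ∫ z, circlePow (b.1 - a.1) z ∂(rotMeasure α μ a.2) else 0 := by
  have h1 : ⟪trigVec α μ a, trigVec α μ b⟫_ℂ = ∫ z, conj (circlePow a.1 z) *
      (if a.2 = b.2 then circlePow b.1 z else 0) ∂(rotMeasure α μ a.2) := by
    rw [inner_trigVec]
    exact integral_congr_ae ((trigVec_ae b a.2).mono fun z hz => by simp only [hz])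
  rw [h1]
  split_ifs with h
  · refine integral_congr_ae (Filter.Eventually.of_forall fun z => ?_)
    change conj (circlePow a.1 z) * circlePow b.1 z = circlePow (b.1 - a.1) z
    rw [conj_circlePow, circlePow_apply, circlePow_apply, circlePow_apply, ← Circle.coe_mul,
      ← zpow_add, neg_add_eq_sub]
  · simp

theorem span_trigVec_closure_eq_top :
    (Submodule.span ℂ (Set.range (trigVec α μ))).topologicalClosure = ⊤ := by
  rw [Submodule.topologicalClosure_eq_top_iff, Submodule.eq_bot_iff]
  intro x hx
  rw [Submodule.mem_orthogonal] at hx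
  refine lp.ext (funext fun n => ?_)
  refine eq_zero_of_inner_circlePowLp fun m => ?_
  have h := hx _ (Submodule.subset_span ⟨(m, n), rfl⟩)
  rwa [trigVec, lp.inner_single_left] at h

/-- Polarization: since `i J y = J(-i y)`, the two imaginary terms are interchanged. -/
theorem LinearIsometryEquiv.inner_map_map_conj {H : Type*} [NormedAddCommGroup H]
    [InnerProductSpace ℂ H] (J : H ≃ₗᵢ⋆[ℂ] H) (x y : H) : ⟪J x, J y⟫_ℂ = ⟪y, x⟫_ℂ := by
  have h1 : Complex.I • J y = J (-(Complex.I • y)) := by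
    rw [map_neg, J.map_smulₛₗ]; simp
  have h2 : ‖x + Complex.I • y‖ = ‖y - Complex.I • x‖ := by
    rw [← one_mul ‖x + Complex.I • y‖, ← show ‖-Complex.I‖ = 1 by simp, ← norm_smul]
    congr 1
    simp [smul_smul]
    abel
  have h3 : ‖x - Complex.I • y‖ = ‖y + Complex.I • x‖ := by
    rw [← one_mul ‖x - Complex.I • y‖, ← show ‖Complex.I‖ = 1 by simp, ← norm_smul]
    congr 1
    simp [smul_sub, smul_smul]
    abel
  rw [inner_eq_sum_norm_sq_div_four, inner_eq_sum_norm_sq_div_four]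
  simp only [RCLike.I_to_complex]
  rw [h1, ← map_add, ← map_sub, ← map_sub, ← map_add, J.norm_map, J.norm_map, J.norm_map,
    J.norm_map, sub_neg_eq_add, ← sub_eq_add_neg, h2, h3, add_comm x y, norm_sub_rev x y]

variable
  (hμ : ∀ n : ℤ, rotMeasure α μ (-n) ≪ rotMeasure α μ n ∧ rotMeasure α μ n ≪ rotMeasure α μ (-n))

include hμ

theorem trigVec_involution (a : ℤ × ℤ) (n : ℤ) :
    trigVec α μ (-a) n =ᵐ[rotMeasure α μ n] fun z => conj (trigVec α μ a (-n) z) := by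
  filter_upwards [trigVec_ae (-a) n, (hμ n).2.ae_le (trigVec_ae a (-n))] with z h1 h2
  rw [h1, h2, Prod.snd_neg, Prod.fst_neg, ← conj_circlePow]
  simp only [neg_eq_iff_eq_neg]
  split_ifs <;> simp

theorem trigVec_mem_mulGraph (a : ℤ × ℤ) : (trigVec α μ a, rotConj hμ (trigVec α μ (-a))) ∈
    mulGraph (rotMeasure α μ) fun n z => √(rotDensity α μ n z) :=
  (rotInvolution_iff hμ).1 (trigVec_involution hμ a)

/-- As `(J y)_{-n} = conj(x_n)`, the second inner product is `∫ conj(z^m) x_n dμ_{-n}`. The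
hypothesis thus says that `x_n` has zero Fourier coefficients for `μ_n + μ_{-n}`. -/
theorem eq_zero_of_inner_trigVec {x y : rotHilbert α μ}
    (hxy : (x, y) ∈ mulGraph (rotMeasure α μ) fun n z => √(rotDensity α μ n z))
    (h : ∀ a, ⟪trigVec α μ a, x⟫_ℂ + ⟪rotConj hμ (trigVec α μ (-a)), y⟫_ℂ = 0) : x = 0 := by
  have hs : ∀ n, rotConj hμ y n =ᵐ[rotMeasure α μ n] fun z => conj (x (-n) z) :=
    (rotInvolution_iff hμ).2 (by rwa [rotConj_rotConj])
  refine lp_two_ext fun n => ?_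
  have hs' : x n =ᵐ[rotMeasure α μ (-n)] fun z => conj (rotConj hμ y (-n) z) := by
    have h1 := hs (-n)
    rw [neg_neg] at h1
    filter_upwards [h1] with z hz
    rw [hz, Complex.conj_conj]
  have hx1 : MemLp (x n) 2 (rotMeasure α μ n) := Lp.memLp _
  -- The chosen representative of `x_n` is also square-integrable for `μ_{-n}`, because there it
  -- agrees with the conjugate of a component of `J y`.
  have hx2 : MemLp (x n) 2 (rotMeasure α μ (-n)) :=
    (memLp_congr_ae hs').2 (Lp.memLp (rotConj hμ y (-n))).star
  have hx : MemLp (x n) 2 (rotMeasure α μ n + rotMeasure α μ (-n)) := by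
    refine ⟨(Lp.stronglyMeasurable (x n)).aestronglyMeasurable, ?_⟩
    rw [eLpNorm_lt_top_iff_lintegral_rpow_enorm_lt_top two_ne_zero ENNReal.ofNat_ne_top,
      lintegral_add_measure]
    exact ENNReal.add_lt_top.2
      ⟨(eLpNorm_lt_top_iff_lintegral_rpow_enorm_lt_top two_ne_zero ENNReal.ofNat_ne_top).1 hx1.2,
      (eLpNorm_lt_top_iff_lintegral_rpow_enorm_lt_top two_ne_zero ENNReal.ofNat_ne_top).1 hx2.2⟩
  have hint : ∀ (ρ : Measure Circle) [IsFiniteMeasure ρ], MemLp (x n) 2 ρ → ∀ m,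
      Integrable (fun z => conj (circlePow m z) * x n z) ρ := by
    intro ρ _ hρ m
    refine (hρ.integrable one_le_two).bdd_mul (c := 1)
      (Complex.continuous_conj.comp (circlePow m).continuous).aestronglyMeasurable ?_
    exact Filter.Eventually.of_forall fun z => by
      rw [RCLike.norm_conj, circlePow_apply, Circle.norm_coe]
  have h0 := ae_eq_zero_of_integral_circlePow hx fun m => by
    rw [integral_add_measure (hint _ hx1 m) (hint _ hx2 m), ← inner_trigVec (m, n) x,
      ← h (m, n)]
    congr 1
    have h1 := (rotConj hμ).inner_map_map_conj (trigVec α μ (-(m, n))) (rotConj hμ y)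
    rw [rotConj_rotConj] at h1
    rw [h1, ← inner_conj_symm, inner_trigVec, ← integral_conj]
    refine integral_congr_ae ?_
    filter_upwards [hs'] with z hz
    simp only [Prod.fst_neg, Prod.snd_neg]
    rw [hz, map_mul, Complex.conj_conj, conj_circlePow]
  filter_upwards [(Measure.le_add_right le_rfl : _ ≤ rotMeasure α μ n +
    rotMeasure α μ (-n)).absolutelyContinuous.ae_le h0, Lp.coeFn_zero ℂ 2 (rotMeasure α μ n)]
    with z h1 h2
  rw [h1]
  exact h2.symm

/-- The trigonometric polynomials are a core of `Δ^{1/2}`. -/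
theorem mulGraph_le_closure_span_trigVec {x y : rotHilbert α μ}
    (hxy : (x, y) ∈ mulGraph (rotMeasure α μ) fun n z => √(rotDensity α μ n z)) :
    (x, y) ∈ closure (Submodule.span ℂ (Set.range fun a =>
      (trigVec α μ a, rotConj hμ (trigVec α μ (-a)))) : Set (rotHilbert α μ × rotHilbert α μ)) := by
  -- The product carries the sup norm; `WithLp 2` supplies the inner product needed for orthogonal
  -- complements, with the same topology.
  let e := WithLp.prodContinuousLinearEquiv 2 ℂ (rotHilbert α μ) (rotHilbert α μ)
  let Γ := (mulGraph (rotMeasure α μ) fun n z => √(rotDensity α μ n z)).comap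
    (e : WithLp 2 (rotHilbert α μ × rotHilbert α μ) →ₗ[ℂ] _)
  let D := Submodule.span ℂ (Set.range fun a =>
      (trigVec α μ a, rotConj hμ (trigVec α μ (-a))))
  let K := (D.comap (e : WithLp 2 (rotHilbert α μ × rotHilbert α μ) →ₗ[ℂ] _)).topologicalClosure
  have hΓ : IsClosed (Γ : Set (WithLp 2 (rotHilbert α μ × rotHilbert α μ))) :=
    (isClosed_mulGraph (fun n => (measurable_rotDensity α μ n).sqrt)
      fun n z => Real.sqrt_nonneg _).preimage e.continuous
  have hDΓ : D ≤ mulGraph (rotMeasure α μ) fun n z => √(rotDensity α μ n z) := by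
    refine Submodule.span_le.2 ?_
    rintro _ ⟨a, rfl⟩
    exact trigVec_mem_mulGraph hμ a
  have hKΓ : K ≤ Γ := Submodule.topologicalClosure_minimal _ (Submodule.comap_mono hDΓ) hΓ
  have : CompleteSpace K := (Submodule.isClosed_topologicalClosure _).completeSpace_coe
  have hbot : Kᗮ ⊓ Γ = ⊥ := by
    rw [Submodule.eq_bot_iff]
    rintro p ⟨hp1, hp2⟩
    have hp3 : (p.fst, p.snd) ∈
      mulGraph (rotMeasure α μ) fun n z => √(rotDensity α μ n z) := hp2
    have h1 : p.fst = 0 := eq_zero_of_inner_trigVec hμ hp3 fun a => by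
      have h2 := (Submodule.mem_orthogonal _ _).1 hp1
        (WithLp.toLp 2 (trigVec α μ a, rotConj hμ (trigVec α μ (-a))))
        (Submodule.le_topologicalClosure _ (Submodule.subset_span ⟨a, rfl⟩))
      rwa [WithLp.prod_inner_apply] at h2
    rw [h1] at hp3
    have h2 : p.snd = 0 := eq_zero_of_mem_mulGraph hp3
    exact WithLp.ofLp_injective 2 (Prod.ext h1 h2)
  have hK : K = Γ := by
    have := Submodule.sup_orthogonal_inf_of_hasOrthogonalProjection hKΓ
    rwa [hbot, sup_bot_eq] at this
  have h1 : e.symm (x, y) ∈ K := by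
    rw [hK]
    exact hxy
  have h2 : e.symm (x, y) ∈ e ⁻¹' closure (D : Set (rotHilbert α μ × rotHilbert α μ)) := by
    have h3 := e.toHomeomorph.preimage_closure (D : Set (rotHilbert α μ × rotHilbert α μ))
    change e ⁻¹' closure _ = closure (e ⁻¹' _) at h3
    rw [h3]
    exact h1
  exact h2

end Trigonometric

/-! ### Weyl elements -/

/-- The phase `e^{2πiα}`. -/
def rotPhase (α : ℝ) : Circle := Circle.exp (2 * Real.pi * α)

theorem rotPhase_zpow (α : ℝ) (n : ℤ) : rotPhase α ^ n = Circle.exp (2 * Real.pi * α * n) := by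
  rw [rotPhase, ← Circle.exp_intCast_mul, mul_comm (n : ℝ)]

theorem Circle.smul_coe_mem_unitary {B : Type*} [CStarAlgebra B] (c : Circle) :
    (c : ℂ) • (1 : B) ∈ unitary B := by
  rw [Unitary.mem_iff, star_smul, star_one, smul_mul_smul_comm, smul_mul_smul_comm, mul_one,
    Complex.star_def, ← Circle.coe_inv_eq_conj, ← Circle.coe_mul, ← Circle.coe_mul]
  simp

/-- Scalars of modulus one as unitaries. -/
def Circle.toUnitary (B : Type*) [CStarAlgebra B] : Circle →* unitary B where
  toFun c := ⟨(c : ℂ) • (1 : B), c.smul_coe_mem_unitary⟩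
  map_one' := Subtype.ext (by simp)
  map_mul' c d := Subtype.ext (by simp [smul_smul, mul_comm])

theorem Circle.coe_toUnitary_mul {B : Type*} [CStarAlgebra B] (c : Circle) (x : unitary B) :
    ((Circle.toUnitary B c * x : unitary B) : B) = (c : ℂ) • (x : B) := by
  change (c : ℂ) • (1 : B) * (x : B) = _
  rw [smul_mul_assoc, one_mul]

theorem Circle.toUnitary_commute {B : Type*} [CStarAlgebra B] (c : Circle) (x : unitary B) :
    Commute (Circle.toUnitary B c) x := Subtype.ext (by
  change (c : ℂ) • (1 : B) * (x : B) = x * ((c : ℂ) • (1 : B))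
  rw [smul_mul_assoc, one_mul, mul_smul_comm, mul_one])

/-- Conjugation by `u` sends `v` to `z v`, hence `v^n` to `z^n v^n`; each exchange of `v` and `u`
costs one central factor. -/
theorem zpow_mul_zpow_of_central {G : Type*} [Group G] {u v z : G} (hz : ∀ g, Commute z g)
    (h : u * v = z * (v * u)) (m n : ℤ) : v ^ n * u ^ m = z ^ (-(m * n)) * (u ^ m * v ^ n) := by
  have h1 : SemiconjBy u v (z * v) := by rw [SemiconjBy, h, mul_assoc]
  have h2 : SemiconjBy u (v ^ n) (z ^ n * v ^ n) := by
    have := h1.zpow_right n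
    rwa [(hz v).mul_zpow] at this
  have h3 : SemiconjBy (v ^ n) u (z ^ (-n) * u) := by
    have h4 : u * v ^ n = z ^ n * v ^ n * u := h2
    rw [SemiconjBy, mul_assoc, h4, zpow_neg, mul_assoc, inv_mul_cancel_left]
  have h5 := h3.zpow_right m
  rw [((hz u).zpow_left (-n)).mul_zpow, ← zpow_mul, neg_mul, mul_comm n m] at h5
  rw [← mul_assoc]
  exact h5

namespace NCTorus

variable (α : ℝ)

theorem coe_weyl (a : ℤ × ℤ) : weyl α a =
    ((Circle.toUnitary (NCTorus α) (rotPhase α ^ (-(a.1 * a.2))) * (U α ^ a.1 * V α ^ a.2) :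
      unitary (NCTorus α)) : NCTorus α) := by
  rw [Circle.coe_toUnitary_mul, weyl, rotPhase_zpow]
  congr 3
  push_cast
  ring

theorem V_zpow_mul_U_zpow (m n : ℤ) : V α ^ n * U α ^ m =
    Circle.toUnitary (NCTorus α) (rotPhase α ^ (-(2 * (m * n)))) * (U α ^ m * V α ^ n) := by
  have h := zpow_mul_zpow_of_central (u := U α) (v := V α)
    (z := Circle.toUnitary (NCTorus α) (rotPhase α ^ (2 : ℤ))) (Circle.toUnitary_commute _)
    (Subtype.ext (by
      rw [Circle.coe_toUnitary_mul, rotPhase_zpow]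
      refine (U_mul_V α).trans ?_
      rw [show 2 * Real.pi * α * ((2 : ℤ) : ℝ) = 4 * Real.pi * α by push_cast; ring]
      rfl)) m n
  rw [h, ← map_zpow, ← zpow_mul, mul_neg]

/-- With `q = e^{2πiα}`, reordering `V^{-n} U^{-m}` costs `q^{-2mn}`. The phase `q^{-mn}` in `weyl`
is half of that, which makes the adjoint free of phases. -/
theorem star_weyl (a : ℤ × ℤ) : star (weyl α a) = weyl α (-a) := by
  rw [coe_weyl, coe_weyl, ← Unitary.coe_star, Unitary.star_eq_inv, mul_inv_rev, mul_inv_rev,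
    ← zpow_neg, ← zpow_neg, V_zpow_mul_U_zpow, ← map_inv, ← zpow_neg,
    ← (Circle.toUnitary_commute _ _).eq, ← mul_assoc, ← map_mul, ← zpow_add, Prod.fst_neg,
    Prod.snd_neg]
  congr 5
  ring

theorem exists_weyl_mul (a b : ℤ × ℤ) : ∃ c : ℂ, weyl α a * weyl α b = c • weyl α (a + b) := by
  set τ := Circle.toUnitary (NCTorus α)
  have h1 : U α ^ a.1 * V α ^ a.2 * (U α ^ b.1 * V α ^ b.2) =
      τ (rotPhase α ^ (-(2 * (b.1 * a.2)))) * (U α ^ (a.1 + b.1) * V α ^ (a.2 + b.2)) := by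
    rw [mul_assoc, ← mul_assoc (V α ^ a.2), V_zpow_mul_U_zpow, mul_assoc, ← mul_assoc,
      ← (Circle.toUnitary_commute _ (U α ^ a.1)).eq, mul_assoc, zpow_add, zpow_add]
    simp only [mul_assoc, τ]
  refine ⟨((rotPhase α ^ (-(a.1 * a.2)) * rotPhase α ^ (-(b.1 * b.2)) *
    rotPhase α ^ (-(2 * (b.1 * a.2))) * (rotPhase α ^ (-((a + b).1 * (a + b).2)))⁻¹ : Circle) : ℂ),
    ?_⟩
  rw [coe_weyl, coe_weyl, coe_weyl, ← Submonoid.coe_mul, ← Circle.coe_toUnitary_mul, mul_assoc,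
    ← mul_assoc _ (τ _), ← (Circle.toUnitary_commute _ (U α ^ a.1 * V α ^ a.2)).eq, mul_assoc, h1]
  simp only [τ, ← mul_assoc, ← map_mul, inv_mul_cancel_right]
  rfl

/-- Products and adjoints of Weyl elements are scalar multiples of Weyl elements, so their span is
already the ⋆-algebra generated by `U` and `V`. -/
theorem span_weyl_closure_eq_top :
    (Submodule.span ℂ (Set.range (weyl α))).topologicalClosure = ⊤ := by
  rw [Submodule.eq_top_iff']
  intro x
  have hx : (x.1 : TorusProduct α) ∈ closure ((StarAlgebra.adjoin ℂ
    {(TorusProduct.ofUnitary (fun i : TorusPair α => i.u) : TorusProduct α),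
     (TorusProduct.ofUnitary (fun i : TorusPair α => i.v) : TorusProduct α)} :
      StarSubalgebra ℂ (TorusProduct α)) : Set (TorusProduct α)) := x.2
  have h1 : weyl α (1, 0) = U α := by
    simp [weyl]
  have h2 : weyl α (0, 1) = V α := by
    simp [weyl]
  have h3 : weyl α 0 = 1 := by
    simp [weyl]
  have hmul : ∀ y ∈ Submodule.span ℂ (Set.range (weyl α)),
      ∀ z ∈ Submodule.span ℂ (Set.range (weyl α)),
        y * z ∈ Submodule.span ℂ (Set.range (weyl α)) := by
    intro y hy z hz
    have h := Submodule.mul_mem_mul hy hz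
    rw [Submodule.span_mul_span] at h
    refine Submodule.span_le.2 ?_ h
    rintro _ ⟨_, ⟨a, rfl⟩, _, ⟨b, rfl⟩, rfl⟩
    obtain ⟨c, hc⟩ := exists_weyl_mul α a b
    simp only [hc]
    exact Submodule.smul_mem _ _ (Submodule.subset_span ⟨_, rfl⟩)
  have hstar : ∀ y ∈ Submodule.span ℂ (Set.range (weyl α)),
      star y ∈ Submodule.span ℂ (Set.range (weyl α)) := by
    intro y hy
    induction hy using Submodule.span_induction with
    | mem y hy =>
      obtain ⟨a, rfl⟩ := hy
      rw [star_weyl]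
      exact Submodule.subset_span ⟨_, rfl⟩
    | zero => rw [star_zero]; exact Submodule.zero_mem _
    | add y z _ _ hy hz => rw [star_add]; exact Submodule.add_mem _ hy hz
    | smul c y _ hy => rw [star_smul]; exact Submodule.smul_mem _ _ hy
  have key : ∀ y ∈ (StarAlgebra.adjoin ℂ
    {(TorusProduct.ofUnitary (fun i : TorusPair α => i.u) : TorusProduct α),
     (TorusProduct.ofUnitary (fun i : TorusPair α => i.v) : TorusProduct α)} :
      StarSubalgebra ℂ (TorusProduct α)),
      ∃ w : NCTorus α, w ∈ Submodule.span ℂ (Set.range (weyl α)) ∧ w.1 = y := by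
    intro y hy
    induction hy using StarAlgebra.adjoin_induction with
    | mem y hy =>
      rcases hy with rfl | rfl
      · exact ⟨(U α : NCTorus α), by rw [← h1]; exact Submodule.subset_span ⟨_, rfl⟩, rfl⟩
      · exact ⟨(V α : NCTorus α), by rw [← h2]; exact Submodule.subset_span ⟨_, rfl⟩, rfl⟩
    | algebraMap c =>
      refine ⟨c • weyl α 0, Submodule.smul_mem _ _ (Submodule.subset_span ⟨_, rfl⟩), ?_⟩
      rw [h3, Algebra.algebraMap_eq_smul_one]
      rfl
    | add y z _ _ hy hz =>
      obtain ⟨y, hy, rfl⟩ := hy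
      obtain ⟨z, hz, rfl⟩ := hz
      exact ⟨y + z, Submodule.add_mem _ hy hz, rfl⟩
    | mul y z _ _ hy hz =>
      obtain ⟨y, hy, rfl⟩ := hy
      obtain ⟨z, hz, rfl⟩ := hz
      exact ⟨y * z, hmul y hy z hz, rfl⟩
    | star y _ hy =>
      obtain ⟨y, hy, rfl⟩ := hy
      exact ⟨star y, hstar y hy, rfl⟩
  exact (closure_subtype (p := fun y => y ∈ torusSubalgebra α) (x := x)).2 (closure_mono key hx)

end NCTorus

/-! ### The representation on `⨁_n L²(𝕋, μ_n)` -/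

section Gram

theorem denseRange_linearCombination {ι H : Type*} [NormedAddCommGroup H] [InnerProductSpace ℂ H]
    {e : ι → H} (he : (Submodule.span ℂ (Set.range e)).topologicalClosure = ⊤) :
    DenseRange (Finsupp.linearCombination ℂ e) := by
  rw [← Submodule.dense_iff_topologicalClosure_eq_top] at he
  rwa [DenseRange, ← LinearMap.coe_range, Finsupp.range_linearCombination]

/-- Equal Gram matrices give equal norms to corresponding linear combinations, so linear
independence is not required. -/
theorem exists_linearIsometryEquiv_of_gram {ι H K : Type*} [NormedAddCommGroup H]
    [InnerProductSpace ℂ H] [CompleteSpace H] [NormedAddCommGroup K] [InnerProductSpace ℂ K]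
    [CompleteSpace K] {e : ι → H} {f : ι → K}
    (he : (Submodule.span ℂ (Set.range e)).topologicalClosure = ⊤)
    (hf : (Submodule.span ℂ (Set.range f)).topologicalClosure = ⊤)
    (h : ∀ i j, ⟪f i, f j⟫_ℂ = ⟪e i, e j⟫_ℂ) : ∃ T : H ≃ₗᵢ[ℂ] K, ∀ i, T (e i) = f i := by
  have hd := denseRange_linearCombination he
  have hd' := denseRange_linearCombination hf
  have hn : ∀ x, ‖Finsupp.linearCombination ℂ f x‖ = ‖Finsupp.linearCombination ℂ e x‖ := by
    intro x
    rw [@norm_eq_sqrt_re_inner ℂ, @norm_eq_sqrt_re_inner ℂ]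
    congr 2
    simp only [Finsupp.linearCombination_apply, Finsupp.sum_inner, Finsupp.inner_sum,
      inner_smul_left, inner_smul_right, h]
  refine ⟨(LinearEquiv.refl ℂ (ι →₀ ℂ)).extendOfIsometry (Finsupp.linearCombination ℂ e)
    (Finsupp.linearCombination ℂ f) hd hd' hn, fun i => ?_⟩
  have h1 := LinearEquiv.extendOfIsometry_eq (LinearEquiv.refl ℂ (ι →₀ ℂ))
    (Finsupp.linearCombination ℂ e) (Finsupp.linearCombination ℂ f) hd hd' hn
    (Finsupp.single i 1)
  simpa using h1

theorem LinearIsometryEquiv.zpow_apply_of_shift {H : Type*} [NormedAddCommGroup H]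
    [InnerProductSpace ℂ H] {T : H ≃ₗᵢ[ℂ] H} {w : ℤ → H} {c : Circle}
    (h : ∀ k, T (w k) = (c : ℂ) • w (k + 1)) (k : ℤ) :
    (T ^ k) (w 0) = ((c ^ k : Circle) : ℂ) • w k := by
  induction k using Int.induction_on with
  | zero => simp
  | succ k ih =>
    rw [add_comm, zpow_one_add, LinearIsometryEquiv.coe_mul, Function.comp_apply, ih, map_smul, h, smul_smul,
      zpow_one_add, Circle.coe_mul, mul_comm, add_comm]
  | pred k ih =>
    have h1 := h (-k - 1)
    rw [sub_add_cancel] at h1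
    have h2 : T ((T ^ (-(k : ℤ) - 1)) (w 0)) = (T ^ (-(k : ℤ))) (w 0) := by
      rw [← Function.comp_apply (f := T), ← LinearIsometryEquiv.coe_mul, ← zpow_one_add, add_sub_cancel]
    apply T.injective
    rw [h2, ih, map_smul, h1, smul_smul, ← Circle.coe_mul, ← zpow_add_one, sub_add_cancel]

end Gram

section Representation

variable (α : ℝ) (μ : Measure Circle)

theorem integral_circlePow_rotMeasure (k n : ℤ) : ∫ z, circlePow k z ∂(rotMeasure α μ n) =
    ((rotPhase α ^ (n * k) : Circle) : ℂ) * ∫ z, circlePow k z ∂μ := by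
  rw [rotMeasure, integral_map (measurable_rotation α n).aemeasurable
    (circlePow k).continuous.aestronglyMeasurable, ← integral_const_mul]
  refine integral_congr_ae (Filter.Eventually.of_forall fun z => ?_)
  change circlePow k _ = _ * circlePow k z
  rw [circlePow_apply, circlePow_apply, ← rotPhase_zpow, mul_zpow, ← zpow_mul, Circle.coe_mul]

variable [IsProbabilityMeasure μ]

theorem exists_shift (σ : ℤ × ℤ ≃ ℤ × ℤ) (c : ℤ × ℤ → Circle)
    (h : ∀ a b, ⟪(c a : ℂ) • trigVec α μ (σ a), (c b : ℂ) • trigVec α μ (σ b)⟫_ℂ =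
      ⟪trigVec α μ a, trigVec α μ b⟫_ℂ) :
    ∃ T : rotHilbert α μ ≃ₗᵢ[ℂ] rotHilbert α μ,
      ∀ a, T (trigVec α μ a) = (c a : ℂ) • trigVec α μ (σ a) := by
  refine exists_linearIsometryEquiv_of_gram span_trigVec_closure_eq_top ?_ h
  rw [eq_top_iff, ← span_trigVec_closure_eq_top (α := α) (μ := μ)]
  refine Submodule.topologicalClosure_mono (Submodule.span_le.2 ?_)
  rintro _ ⟨a, rfl⟩
  have h1 : trigVec α μ a =
      ((c (σ.symm a))⁻¹ : ℂ) • (c (σ.symm a) : ℂ) • trigVec α μ (σ (σ.symm a)) := by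
    rw [smul_smul, inv_mul_cancel₀ (Circle.coe_ne_zero _), one_smul, σ.apply_symm_apply]
  rw [h1]
  exact Submodule.smul_mem _ _ (Submodule.subset_span ⟨σ.symm a, rfl⟩)

theorem Circle.conj_coe_mul (c d : Circle) (x : ℂ) :
    conj (c : ℂ) * ((d : ℂ) * x) = ((c⁻¹ * d : Circle) : ℂ) * x := by
  rw [← Circle.coe_inv_eq_conj, Circle.coe_mul, mul_assoc]

/-- The weight is dictated by `U W(m,n) = q^n W(m+1,n)`, `q = e^{2πiα}`. -/
theorem exists_shiftU : ∃ T : rotHilbert α μ ≃ₗᵢ[ℂ] rotHilbert α μ, ∀ a, T (trigVec α μ a) =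
    ((rotPhase α ^ a.2 : Circle) : ℂ) • trigVec α μ (a.1 + 1, a.2) := by
  refine exists_shift α μ ((Equiv.addRight 1).prodCongr (Equiv.refl ℤ)) _ fun a b => ?_
  rw [inner_smul_left, inner_smul_right, Circle.conj_coe_mul, inner_trigVec_trigVec,
    inner_trigVec_trigVec]
  by_cases h : a.2 = b.2
  · simp [h]
  · simp [h]

/-- The weight comes from `V W(m,n) = q^{-m} W(m,n+1)`. It cancels the factor `q^k` that `∫ z^k`
acquires in passing from `μ_n` to `μ_{n+1}`. -/
theorem exists_shiftV : ∃ T : rotHilbert α μ ≃ₗᵢ[ℂ] rotHilbert α μ, ∀ a, T (trigVec α μ a) =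
    ((rotPhase α ^ (-a.1) : Circle) : ℂ) • trigVec α μ (a.1, a.2 + 1) := by
  refine exists_shift α μ ((Equiv.refl ℤ).prodCongr (Equiv.addRight 1)) _ fun a b => ?_
  rw [inner_smul_left, inner_smul_right, Circle.conj_coe_mul, inner_trigVec_trigVec,
    inner_trigVec_trigVec]
  by_cases h : a.2 = b.2
  · simp only [Equiv.prodCongr_apply, Prod.map, Equiv.refl_apply, Equiv.coe_addRight, h, if_true]
    rw [integral_circlePow_rotMeasure, integral_circlePow_rotMeasure, ← mul_assoc,
      ← Circle.coe_mul, ← zpow_neg, ← zpow_add, ← zpow_add]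
    congr 4
    ring
  · simp [h]

instance : Nontrivial (rotHilbert α μ) := by
  refine ⟨trigVec α μ 0, 0, fun h => ?_⟩
  have h1 := inner_trigVec_trigVec (α := α) (μ := μ) 0 0
  rw [h] at h1
  simp [circlePow_apply] at h1

theorem exists_torusRep : ∃ φ : NCTorus α →⋆ₐ[ℂ] (rotHilbert α μ →L[ℂ] rotHilbert α μ),
    ∀ a, φ (NCTorus.weyl α a) (trigVec α μ 0) = trigVec α μ a := by
  obtain ⟨u, hu⟩ := exists_shiftU α μ
  obtain ⟨v, hv⟩ := exists_shiftV α μ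
  let P : TorusPair α :=
    { B := rotHilbert α μ →L[ℂ] rotHilbert α μ
      u := Unitary.linearIsometryEquiv.symm u
      v := Unitary.linearIsometryEquiv.symm v
      comm := by
        refine ContinuousLinearMap.ext_on
          (Submodule.dense_iff_topologicalClosure_eq_top.2
            (span_trigVec_closure_eq_top (α := α) (μ := μ))) ?_
        rintro _ ⟨a, rfl⟩
        change u (v (trigVec α μ a)) = (Circle.exp (4 * Real.pi * α) : ℂ) • v (u (trigVec α μ a))
        rw [hu, hv, map_smul, map_smul, hu, hv, smul_smul, smul_smul, smul_smul,
          show 4 * Real.pi * α = 2 * Real.pi * α * ((2 : ℤ) : ℝ) by push_cast; ring,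
          ← rotPhase_zpow, ← Circle.coe_mul, ← Circle.coe_mul, ← Circle.coe_mul, ← zpow_add,
          ← zpow_add, ← zpow_add]
        congr 3
        ring }
  obtain ⟨φ, ⟨hU, hV⟩, -⟩ := NCTorus.existsUnique_hom α P
  refine ⟨φ, fun a => ?_⟩
  let f : NCTorus α →⋆* P.B :=
    { toFun := φ, map_one' := map_one φ, map_mul' := map_mul φ, map_star' := map_star φ }
  have h1 : Unitary.map f (NCTorus.U α) = P.u := Subtype.ext hU
  have h2 : Unitary.map f (NCTorus.V α) = P.v := Subtype.ext hV
  have h3 : φ ((NCTorus.U α ^ a.1 * NCTorus.V α ^ a.2 : unitary (NCTorus α)) : NCTorus α) =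
      ((P.u ^ a.1 * P.v ^ a.2 : unitary P.B) : P.B) := by
    rw [← h1, ← h2, ← map_zpow, ← map_zpow, ← map_mul]
    rfl
  have h4 : ((P.u ^ a.1 * P.v ^ a.2 : unitary P.B) : P.B) =
      ((u ^ a.1 * v ^ a.2 : rotHilbert α μ ≃ₗᵢ[ℂ] rotHilbert α μ) :
        rotHilbert α μ →L[ℂ] rotHilbert α μ) := by
    rw [← Unitary.coe_symm_linearIsometryEquiv_apply, map_mul, map_zpow, map_zpow]
  have h5 : (v ^ a.2) (trigVec α μ 0) = trigVec α μ (0, a.2) := by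
    have := LinearIsometryEquiv.zpow_apply_of_shift (T := v) (w := fun k => trigVec α μ (0, k))
      (c := 1) (fun k => by rw [hv]; simp) a.2
    simp only [one_zpow, Circle.coe_one, one_smul] at this
    exact this
  -- The factor `q^{mn}` produced here is cancelled by the phase in the definition of `weyl`.
  have h6 : (u ^ a.1) (trigVec α μ (0, a.2)) =
      ((rotPhase α ^ (a.1 * a.2) : Circle) : ℂ) • trigVec α μ a := by
    have := LinearIsometryEquiv.zpow_apply_of_shift (T := u) (w := fun k => trigVec α μ (k, a.2))
      (c := rotPhase α ^ a.2) (fun k => by rw [hu]) a.1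
    rwa [← zpow_mul, mul_comm] at this
  rw [NCTorus.weyl, map_smul, h3, h4]
  change (Circle.exp (-(2 * Real.pi * α * a.1 * a.2)) : ℂ) • (u ^ a.1 * v ^ a.2) (trigVec α μ 0) = _
  rw [LinearIsometryEquiv.coe_mul, Function.comp_apply, h5, h6, smul_smul, ← Circle.coe_mul,
    show -(2 * Real.pi * α * a.1 * a.2) = 2 * Real.pi * α * ((-(a.1 * a.2) : ℤ) : ℝ) by
      push_cast; ring, ← rotPhase_zpow, ← zpow_add]
  simp

end Representation

/-! ### The states `ω_μ` and their GNS representations -/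

section State

theorem tsum_mul_row (k : ℤ → ℂ) (f : ℤ × ℤ →₀ ℂ) (n : ℤ) :
    ∑' m, k m * f (m, n) = f.sum fun a c => if a.2 = n then k a.1 * c else 0 := by
  have hs : ∀ f : ℤ × ℤ →₀ ℂ, Summable fun m => k m * f (m, n) := fun f => by
    refine summable_of_hasFiniteSupport ((f.support.finite_toSet.preimage
      (f := fun m : ℤ => (m, n)) fun a _ b _ hab => congrArg Prod.fst hab).subset fun m hm => ?_)
    have h : f (m, n) ≠ 0 := right_ne_zero_of_mul hm
    simpa using h
  induction f using Finsupp.induction_linear with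
  | zero => simp
  | add f g hf hg =>
    rw [Finsupp.sum_add_index' (by simp) (fun a b c => by split_ifs <;> simp [mul_add]), ← hf, ← hg,
      ← (hs f).tsum_add (hs g)]
    simp [mul_add]
  | single a c =>
    rw [Finsupp.sum_single_index (by simp), tsum_eq_single a.1]
    · by_cases h : a.2 = n
      · subst h; simp
      · rw [Finsupp.single_eq_of_ne (fun h' => h (congrArg Prod.snd h').symm)]
        simp [h]
    · intro m hm
      rw [Finsupp.single_eq_of_ne (fun h' => hm (congrArg Prod.fst h')), mul_zero]

/-- The positive functional `a ↦ ⟨ξ, φ(a) ξ⟩`. -/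
def vectorFunctional {A H : Type*} [CStarAlgebra A] [PartialOrder A] [StarOrderedRing A]
    [NormedAddCommGroup H] [InnerProductSpace ℂ H] [CompleteSpace H]
    (φ : A →⋆ₐ[ℂ] (H →L[ℂ] H)) (ξ : H) : A →ₚ[ℂ] ℂ :=
  PositiveLinearMap.mk₀
    { toFun := fun a => ⟪ξ, φ a ξ⟫_ℂ
      map_add' := fun a b => by simp
      map_smul' := fun c a => by simp }
    fun a ha => by
      obtain ⟨b, rfl⟩ := CStarAlgebra.nonneg_iff_eq_star_mul_self.1 ha
      change 0 ≤ ⟪ξ, φ (star b * b) ξ⟫_ℂ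
      rw [map_mul, map_star, ContinuousLinearMap.star_eq_adjoint, mul_apply_eq_comp,
        ContinuousLinearMap.adjoint_inner_right, inner_self_eq_norm_sq_to_K]
      exact pow_nonneg (Complex.zero_le_real.2 (norm_nonneg (φ b ξ))) 2

theorem vectorFunctional_apply {A H : Type*} [CStarAlgebra A] [PartialOrder A] [StarOrderedRing A]
    [NormedAddCommGroup H] [InnerProductSpace ℂ H] [CompleteSpace H]
    (φ : A →⋆ₐ[ℂ] (H →L[ℂ] H)) (ξ : H) (a : A) : vectorFunctional φ ξ a = ⟪ξ, φ a ξ⟫_ℂ := rfl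

theorem NCTorus.denseRange_W (α : ℝ) : DenseRange (NCTorus.W α) := by
  have h := NCTorus.span_weyl_closure_eq_top α
  rw [← Submodule.dense_iff_topologicalClosure_eq_top, ← Finsupp.range_linearCombination] at h
  exact h

variable {α : ℝ} {μ : Measure Circle}

/-- Positive functionals on a C⋆-algebra are continuous, and the `W(f)` are dense. -/
theorem IsOmega.unique {ω ω' : NCTorus α →ₚ[ℂ] ℂ} (h : IsOmega α μ ω) (h' : IsOmega α μ ω') :
    ω = ω' := by
  have h1 : (ω : NCTorus α → ℂ) = ω' :=
    (NCTorus.denseRange_W α).equalizer (map_continuous ω) (map_continuous ω')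
      (funext fun f => (h f).trans (h' f).symm)
  exact DFunLike.coe_injective h1

variable [IsProbabilityMeasure μ] {φ : NCTorus α →⋆ₐ[ℂ] (rotHilbert α μ →L[ℂ] rotHilbert α μ)}

theorem rep_W_apply (hφ : ∀ a, φ (NCTorus.weyl α a) (trigVec α μ 0) = trigVec α μ a)
    (f : ℤ × ℤ →₀ ℂ) :
    φ (NCTorus.W α f) (trigVec α μ 0) = f.sum fun a c => c • trigVec α μ a := by
  rw [NCTorus.W, Finsupp.sum, map_sum, _root_.sum_apply, Finsupp.sum]
  refine Finset.sum_congr rfl fun a _ => ?_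
  rw [map_smul, _root_.smul_apply, hφ]

theorem isOmega_vectorFunctional
    (hφ : ∀ a, φ (NCTorus.weyl α a) (trigVec α μ 0) = trigVec α μ a) :
    IsOmega α μ (vectorFunctional φ (trigVec α μ 0)) := by
  intro f
  rw [vectorFunctional_apply, rep_W_apply hφ, Finsupp.inner_sum,
    tsum_mul_row fun m => ∫ z, ((z ^ m : Circle) : ℂ) ∂μ]
  refine Finsupp.sum_congr fun a _ => ?_
  rw [inner_smul_right, inner_trigVec_trigVec, Prod.snd_zero, Prod.fst_zero, sub_zero,
    rotMeasure_zero]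
  simp only [eq_comm (a := (0 : ℤ)), mul_comm (f a), ite_mul, zero_mul]
  rfl

theorem rep_W_ae (hφ : ∀ a, φ (NCTorus.weyl α a) (trigVec α μ 0) = trigVec α μ a)
    (f : ℤ × ℤ →₀ ℂ) (n : ℤ) :
    φ (NCTorus.W α f) (trigVec α μ 0) n =ᵐ[rotMeasure α μ n] rowTransform f n := by
  have h1 : ∀ f : ℤ × ℤ →₀ ℂ, rowTransform f n = fun z =>
      f.sum fun a c => if a.2 = n then circlePow a.1 z * c else 0 := fun f => by
    funext z
    rw [rowTransform, ← tsum_mul_row (fun m => circlePow m z)]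
    simp only [circlePow_apply, mul_comm]
  rw [rep_W_apply hφ, h1]
  induction f using Finsupp.induction_linear with
  | zero =>
    simp only [Finsupp.sum_zero_index]
    exact Lp.coeFn_zero _ _ _
  | add f g hf hg =>
    rw [Finsupp.sum_add_index' (by simp) (fun a b c => add_smul b c _)]
    filter_upwards [hf, hg, Lp.coeFn_add ((f.sum fun a c => c • trigVec α μ a) n)
      ((g.sum fun a c => c • trigVec α μ a) n)] with z h2 h3 h4
    rw [Finsupp.sum_add_index' (by simp) (fun a b c => by split_ifs <;> simp [mul_add]), ← h2, ← h3]
    exact h4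
  | single a c =>
    rw [Finsupp.sum_single_index (by simp)]
    filter_upwards [Lp.coeFn_smul c (trigVec α μ a n), trigVec_ae a n] with z h2 h3
    rw [Finsupp.sum_single_index (by simp)]
    refine h2.trans ?_
    rw [Pi.smul_apply, h3]
    simp only [smul_eq_mul, eq_comm (a := n), mul_comm c, ite_mul, zero_mul]

theorem gns_apply_gnsVector {A : Type*} [CStarAlgebra A] [PartialOrder A] [StarOrderedRing A]
    (ω : A →ₚ[ℂ] ℂ) (a : A) :
    ω.gnsStarAlgHom a (gnsVector ω) = ((ω.toPreGNS a : ω.PreGNS) : ω.GNS) := by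
  change ω.gnsNonUnitalStarAlgHom a ((ω.toPreGNS 1 : ω.PreGNS) : ω.GNS) = _
  rw [PositiveLinearMap.gnsNonUnitalStarAlgHom_apply_coe,
    PositiveLinearMap.leftMulMapPreGNS_apply]
  simp

/-- The GNS space of a vector functional with a cyclic vector. -/
theorem exists_gnsEquiv {A H : Type*} [CStarAlgebra A] [PartialOrder A] [StarOrderedRing A]
    [NormedAddCommGroup H] [InnerProductSpace ℂ H] [CompleteSpace H]
    (φ : A →⋆ₐ[ℂ] (H →L[ℂ] H)) (ξ : H) (hξ : DenseRange fun a => φ a ξ) :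
    ∃ Φ : (vectorFunctional φ ξ).GNS ≃ₗᵢ[ℂ] H, ∀ a,
      Φ ((vectorFunctional φ ξ).gnsStarAlgHom a (gnsVector (vectorFunctional φ ξ))) = φ a ξ := by
  set ω := vectorFunctional φ ξ with hω
  let e₁ : A →ₗ[ℂ] ω.GNS :=
    { toFun := fun a => ω.gnsStarAlgHom a (gnsVector ω)
      map_add' := fun a b => by simp only [map_add, _root_.add_apply]
      map_smul' := fun c a => by
        simp only [map_smul, _root_.smul_apply, RingHom.id_apply] }
  let e₂ : A →ₗ[ℂ] H :=
    { toFun := fun a => φ a ξ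
      map_add' := fun a b => by simp only [map_add, _root_.add_apply]
      map_smul' := fun c a => by
        simp only [map_smul, _root_.smul_apply, RingHom.id_apply] }
  have hd : DenseRange e₁ := by
    have h1 : (e₁ : A → ω.GNS) = (fun x : ω.PreGNS => (x : ω.GNS)) ∘ ω.toPreGNS :=
      funext fun a => gns_apply_gnsVector ω a
    rw [h1]
    exact UniformSpace.Completion.denseRange_coe.comp ω.toPreGNS.surjective.denseRange
      (UniformSpace.Completion.continuous_coe _)
  -- Both squared norms equal `ω(a⋆ a)`.
  have hn : ∀ a, ‖e₂ a‖ = ‖e₁ a‖ := by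
    intro a
    change ‖φ a ξ‖ = ‖ω.gnsStarAlgHom a (gnsVector ω)‖
    rw [gns_apply_gnsVector, UniformSpace.Completion.norm_coe]
    have h1 : ((‖ω.toPreGNS a‖ ^ 2 : ℝ) : ℂ) = ((‖φ a ξ‖ ^ 2 : ℝ) : ℂ) := by
      rw [Complex.ofReal_pow, PositiveLinearMap.preGNS_norm_sq, hω, vectorFunctional_apply,
        PositiveLinearMap.ofPreGNS_toPreGNS, map_mul, map_star,
        ContinuousLinearMap.star_eq_adjoint, mul_apply_eq_comp,
        ContinuousLinearMap.adjoint_inner_right, inner_self_eq_norm_sq_to_K]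
      simp
    exact ((sq_eq_sq₀ (norm_nonneg _) (norm_nonneg _)).1 (Complex.ofReal_injective h1)).symm
  refine ⟨(LinearEquiv.refl ℂ A).extendOfIsometry e₁ e₂ hd hξ hn, fun a => ?_⟩
  exact LinearEquiv.extendOfIsometry_eq (LinearEquiv.refl ℂ A) e₁ e₂ hd hξ hn a

variable
  (hμ : ∀ n : ℤ, rotMeasure α μ (-n) ≪ rotMeasure α μ n ∧ rotMeasure α μ n ≪ rotMeasure α μ (-n))
  (hφ : ∀ a, φ (NCTorus.weyl α a) (trigVec α μ 0) = trigVec α μ a)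

include hφ in
theorem denseRange_rep : DenseRange fun a => φ a (trigVec α μ 0) := by
  have h := span_trigVec_closure_eq_top (α := α) (μ := μ)
  rw [← Submodule.dense_iff_topologicalClosure_eq_top, ← Finsupp.range_linearCombination] at h
  refine h.mono ?_
  rintro _ ⟨f, rfl⟩
  exact ⟨NCTorus.W α f, rep_W_apply hφ f⟩

theorem star_W (f : ℤ × ℤ →₀ ℂ) :
    star (NCTorus.W α f) = f.sum fun a c => conj c • NCTorus.weyl α (-a) := by
  rw [NCTorus.W, Finsupp.sum, star_sum, Finsupp.sum]
  refine Finset.sum_congr rfl fun a _ => ?_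
  rw [star_smul, NCTorus.star_weyl]
  rfl

include hφ in
theorem rep_star_W_apply (f : ℤ × ℤ →₀ ℂ) : φ (star (NCTorus.W α f)) (trigVec α μ 0) =
    f.sum fun a c => conj c • trigVec α μ (-a) := by
  rw [star_W, Finsupp.sum, map_sum, _root_.sum_apply, Finsupp.sum]
  refine Finset.sum_congr rfl fun a _ => ?_
  rw [map_smul, _root_.smul_apply, hφ]

include hφ in
/-- The closure of `φ(a) ξ ↦ φ(a⋆) ξ` is `J Δ^{1/2}`. -/
theorem mem_closure_rep_iff {x y : rotHilbert α μ} :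
    (x, y) ∈ closure (Set.range fun a => (φ a (trigVec α μ 0), φ (star a) (trigVec α μ 0))) ↔
      (x, rotConj hμ y) ∈ mulGraph (rotMeasure α μ) fun n z => √(rotDensity α μ n z) := by
  -- Applying `J` to the second coordinate turns the graph of a conjugate-linear map into a complex
  -- subspace.
  let E : rotHilbert α μ × rotHilbert α μ ≃ₜ rotHilbert α μ × rotHilbert α μ :=
    (Homeomorph.refl _).prodCongr (rotConj hμ).toHomeomorph
  have hW : ∀ f : ℤ × ℤ →₀ ℂ, E (φ (NCTorus.W α f) (trigVec α μ 0),
      φ (star (NCTorus.W α f)) (trigVec α μ 0)) = Finsupp.linearCombination ℂ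
        (fun a => (trigVec α μ a, rotConj hμ (trigVec α μ (-a)))) f := by
    intro f
    rw [rep_W_apply hφ, rep_star_W_apply hφ, Finsupp.linearCombination_apply]
    refine Prod.ext ?_ ?_
    · change (f.sum fun a c => c • trigVec α μ a) = _
      rw [Finsupp.sum, Finsupp.sum, Prod.fst_sum]
      rfl
    · change rotConj hμ (f.sum fun a c => conj c • trigVec α μ (-a)) = _
      rw [Finsupp.sum, Finsupp.sum, map_sum]
      rw [Prod.snd_sum]
      refine Finset.sum_congr rfl fun a _ => ?_
      rw [(rotConj hμ).map_smulₛₗ, Complex.conj_conj]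
      rfl
  have hcl := isClosed_mulGraph (ν := rotMeasure α μ) (g := fun n z => √(rotDensity α μ n z))
    (fun n => (measurable_rotDensity α μ n).sqrt) fun n z => Real.sqrt_nonneg _
  change _ ↔ E (x, y) ∈ _
  constructor
  · intro h
    have hcl' := hcl.preimage E.continuous
    refine closure_minimal ?_ hcl' h
    have hc : Continuous fun a => (φ a (trigVec α μ 0), φ (star a) (trigVec α μ 0)) := by
      have h1 : Continuous φ := map_continuous φ
      fun_prop
    rintro _ ⟨a, rfl⟩
    refine (NCTorus.denseRange_W α).induction_on (p := fun a =>
      (φ a (trigVec α μ 0), φ (star a) (trigVec α μ 0)) ∈ E ⁻¹' (mulGraph (rotMeasure α μ)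
        fun n z => √(rotDensity α μ n z) : Set _)) a (hcl'.preimage hc) fun f => ?_
    rw [Set.mem_preimage, hW]
    refine Submodule.sum_mem _ fun a _ => Submodule.smul_mem _ _ (trigVec_mem_mulGraph hμ a)
  · intro h
    have h1 := mulGraph_le_closure_span_trigVec hμ h
    have h2 : (x, y) ∈ E ⁻¹' closure (Submodule.span ℂ (Set.range fun a =>
      (trigVec α μ a, rotConj hμ (trigVec α μ (-a)))) : Set _) := h1
    rw [E.preimage_closure] at h2
    refine closure_mono ?_ h2
    intro p hp
    rw [Set.mem_preimage, ← Finsupp.range_linearCombination] at hp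
    obtain ⟨f, hf⟩ := hp
    rw [← hW] at hf
    exact ⟨NCTorus.W α f, E.injective hf⟩

include hμ in
-- `h_n` vanishes almost nowhere, since `h_n h_{-n} = 1`. This injectivity of `Δ^{1/2}` is what
-- determines `J`.
theorem eq_zero_of_mem_mulGraph_sqrt {x : rotHilbert α μ}
    (hx : (x, 0) ∈ mulGraph (rotMeasure α μ) fun n z => √(rotDensity α μ n z)) : x = 0 := by
  refine lp_two_ext fun n => ?_
  filter_upwards [hx n, Lp.coeFn_zero ℂ 2 (rotMeasure α μ n), rotDensity_mul_neg hμ n]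
    with z h1 h2 h3
  simp only [lp.coeFn_zero, Pi.zero_apply] at h1 h2 ⊢
  rw [h2] at h1 ⊢
  refine (mul_eq_zero.1 h1.symm).resolve_left ?_
  have h4 : rotDensity α μ n z ≠ 0 := left_ne_zero_of_mul_eq_one h3
  rw [← ne_eq, Complex.ofReal_ne_zero, Real.sqrt_ne_zero (rotDensity_nonneg α μ n z)]
  exact h4

theorem isPolarDecomposition_tomitaGraph {ω : NCTorus α →ₚ[ℂ] ℂ}
    (Φ : ω.GNS ≃ₗᵢ[ℂ] rotHilbert α μ)
    (hφ : ∀ a, φ (NCTorus.weyl α a) (trigVec α μ 0) = trigVec α μ a)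
    (hΦ : ∀ a, Φ (ω.gnsStarAlgHom a (gnsVector ω)) = φ a (trigVec α μ 0)) :
    IsPolarDecomposition (tomitaGraph ω) ((Φ.trans (rotConj hμ)).trans Φ.symm)
      (mulOp Φ fun n z => √(rotDensity α μ n z)) := by
  have hm : ∀ n, Measurable fun z => √(rotDensity α μ n z) :=
    fun n => (measurable_rotDensity α μ n).sqrt
  have h0 : ∀ n z, 0 ≤ √(rotDensity α μ n z) := fun n z => Real.sqrt_nonneg _
  refine ⟨isSelfAdjoint_mulOp hm h0, mulOp_nonneg hm h0, fun x y => ?_⟩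
  let E : ω.GNS × ω.GNS ≃ₜ rotHilbert α μ × rotHilbert α μ :=
    Φ.toHomeomorph.prodCongr Φ.toHomeomorph
  have h1 : (x, y) ∈ tomitaGraph ω ↔ (Φ x, Φ y) ∈
      closure (Set.range fun a => (φ a (trigVec α μ 0), φ (star a) (trigVec α μ 0))) := by
    have h2 : {p | ∃ a, p = (ω.gnsStarAlgHom a (gnsVector ω),
        ω.gnsStarAlgHom (star a) (gnsVector ω))} =
        E ⁻¹' (Set.range fun a => (φ a (trigVec α μ 0), φ (star a) (trigVec α μ 0))) := by
      ext p
      refine exists_congr fun a => ?_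
      simp only
      rw [← hΦ, ← hΦ, ← E.injective.eq_iff, eq_comm]
      rfl
    rw [tomitaGraph, h2, ← E.preimage_closure]
    rfl
  rw [h1, mem_closure_rep_iff hμ hφ]
  have h3 : ∀ w, (Φ.trans (rotConj hμ)).trans Φ.symm w = Φ.symm (rotConj hμ (Φ w)) := fun w => rfl
  simp only [h3]
  constructor
  · intro h
    have h4 : (x, Φ.symm (rotConj hμ (Φ y))) ∈
        (mulOp Φ fun n z => √(rotDensity α μ n z)).graph := mem_graph_mulOp.2 (by simpa using h)
    obtain ⟨⟨u, hu⟩, rfl, h5⟩ := (LinearPMap.mem_graph_iff _).1 h4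
    refine ⟨hu, ?_⟩
    rw [h5, Φ.apply_symm_apply, rotConj_rotConj, Φ.symm_apply_apply]
  · rintro ⟨hx, rfl⟩
    rw [Φ.apply_symm_apply, rotConj_rotConj]
    exact mem_graph_mulOp.1 (LinearPMap.mem_graph _ ⟨x, hx⟩)

end State

end

theorem mainTheorem9 (α : ℝ) (hα : Irrational α)
    (μ : Measure Circle) [IsProbabilityMeasure μ]
    (hμ : ∀ n : ℤ, rotMeasure α μ (-n) ≪ rotMeasure α μ n ∧
      rotMeasure α μ n ≪ rotMeasure α μ (-n)) :
    (∃! ω : NCTorus α →ₚ[ℂ] ℂ, IsOmega α μ ω) ∧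
    ∀ ω : NCTorus α →ₚ[ℂ] ℂ, IsOmega α μ ω →
      ∃ Φ : ω.GNS ≃ₗᵢ[ℂ] rotHilbert α μ, IsGNSModel μ ω Φ ∧
        (∃ (Δ : ω.GNS →ₗ.[ℂ] ω.GNS) (J : ω.GNS ≃ₗᵢ⋆[ℂ] ω.GNS), IsModularPair ω Δ J) ∧
        ∀ (Δ : ω.GNS →ₗ.[ℂ] ω.GNS) (J : ω.GNS ≃ₗᵢ⋆[ℂ] ω.GNS), IsModularPair ω Δ J →
          (∀ x : ω.GNS, x ∈ Δ.domain ↔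
            ∑' n : ℤ, ∫⁻ z, ‖(rotDensity α μ n z : ℂ) * Φ x n z‖ₑ ^ 2 ∂(rotMeasure α μ n) < ∞) ∧
          (∀ (x : Δ.domain) (n : ℤ),
            Φ (Δ x) n =ᵐ[rotMeasure α μ n] fun z => (rotDensity α μ n z : ℂ) * Φ x n z) ∧
          (∀ (x : ω.GNS) (n : ℤ),
            Φ (J x) n =ᵐ[rotMeasure α μ n]
              fun z => (√(rotDensity α μ n z) : ℂ) * conj (Φ x (-n) z)) := by
  obtain ⟨φ, hφ⟩ := exists_torusRep α μ
  have hω := isOmega_vectorFunctional hφ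
  refine ⟨⟨_, hω, fun ω' h' => h'.unique hω⟩, fun ω h => ?_⟩
  -- From here `ω` is the vector functional, whose GNS space is identified by cyclicity.
  obtain rfl := h.unique hω
  obtain ⟨Φ, hΦ⟩ := exists_gnsEquiv φ (trigVec α μ 0) (denseRange_rep hφ)
  have hm := measurable_rotDensity α μ
  have h0 := rotDensity_nonneg α μ
  have hP := isPolarDecomposition_tomitaGraph hμ Φ hφ hΦ
  refine ⟨Φ, fun f n => ?_, ⟨mulOp Φ (rotDensity α μ), _, _, hP, isOperatorSquare_mulOp hm h0⟩, ?_⟩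
  · rw [hΦ]
    exact rep_W_ae hφ f n
  rintro Δ J ⟨T, hT, hΔ⟩
  -- Uniqueness replaces an arbitrary modular pair by the explicit one.
  obtain ⟨rfl, rfl⟩ := hT.unique hP hΔ (isOperatorSquare_mulOp hm h0)
    (exists_mulOp_resolvent hm h0) fun x hx => by
      have h1 := mem_graph_mulOp.1 hx
      rw [map_zero] at h1
      exact (map_eq_zero_iff Φ Φ.injective).1 (eq_zero_of_mem_mulGraph_sqrt hμ h1)
  refine ⟨mem_domain_mulOp_iff hm, mulOp_apply_ae, fun x n => ?_⟩
  change Φ (Φ.symm (rotConj hμ (Φ x))) n =ᵐ[rotMeasure α μ n] _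
  rw [Φ.apply_symm_apply]
  exact rotConj_ae hμ (Φ x) n
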